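/- For elements $x,g$ of a group write $x^g=g^{-1}xg$. An involution is an element of order exactly $2$, and $\mathrm{Cen}_G(x)$ is the centralizer of $x$ in $G$. For a group $G$, an involution $j\in G$ and involutions $s,s'\in G$ write $s\approx_j s'$ if $\mathrm{Cen}_G(js)=\mathrm{Cen}_G(js')$. For a group $G$ with distinct involutions $j,t$ and $A=\mathrm{Cen}_G(j)$ consider the conditions (1) all involutions of $G$ are conjugate in $G$; (2) $A$ is malnormal in $G$, i.e. $A\cap A^g=\{1\}$ for all $g\in G\setminus A$; (3) the product of any two distinct involutions of $G$ has infinite order; (4') for any involution $s\in G$ with $s\approx_j t$ there is some $a\in A$ such that $s=t^a$; (5') for any involution $s\in G$ with $s\ne j$ we have $\mathrm{Cen}_G(js)=\{1\}\cup\{js' : s'\in G \text{ an involution},\ s'\approx_j s\}$; (6') for any involution $s\in G$ with $s\notin AtA$ and $s\neq j$ there is an involution $s'\in G$ with $s'\approx_j s$ such that $\mathrm{Cen}_G(js)=\langle js'\rangle$. **Proposition.** Let $G$ be a group containing involutions $j,t,t'$ with $j\neq t$ and $j^{t'}=t$, let $A=\mathrm{Cen}_G(j)$, and assume that (1)–(3)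 and (4')–(6') hold. Then for any involution $v\in G$ with $v\ne j$ there exists a group $G_1$ containing $G$ as a subgroup such that, with $A_1=\mathrm{Cen}_{G_1}(j)$, there is some $f\in A_1$ with $t^f=v$, and conditions (1)–(3) and (4')–(6') hold with $G_1$ and $A_1$ in place of $G$ and $A$ (and with the same $j$ and $t$, and equivalence $\approx_j$ computed in $G_1$). -/

import Mathlib

universe u

namespace SharplyTwoTransitive

/-- The exponential notation `x ^ g` for conjugation, i.e. `g⁻¹ x g`. -/
def conjBy {G : Type u} [Group G] (x g : G) : G := g⁻¹ * x * g

/-- An involution is an element of order exactly two. -/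
def IsInvolution {G : Type u} [Group G] (s : G) : Prop := orderOf s = 2

/-- The centralizer of an element. -/
def Cen {G : Type u} [Group G] (g : G) : Subgroup G := Subgroup.centralizer {g}

/-- `A` is malnormal in `G`: `A ∩ A ^ g = 1` for all `g ∉ A`. -/
def IsMalnormal {G : Type u} [Group G] (A : Subgroup G) : Prop :=
  ∀ g : G, g ∉ A → ∀ a ∈ A, conjBy a g ∈ A → a = 1

/-- The relation `s ≈_j t` (to be used for involutions `s`, `t`): `Cen (j s) = Cen (j t)`. -/
def EquivRel {G : Type u} [Group G] (j s t : G) : Prop := Cen (j * s) = Cen (j * t)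

/-- The conditions on a group `G` with involutions `j`, `t` and `A = Cen j`. -/
structure Conditions {G : Type u} [Group G] (j t : G) : Prop where
  /-- (1) All involutions of `G` are conjugate. -/
  conj : ∀ r s : G, IsInvolution r → IsInvolution s → ∃ g : G, conjBy r g = s
  /-- (2) `A = Cen j` is malnormal in `G`. -/
  malnormal : IsMalnormal (Cen j)
  /-- (3) The product of two distinct involutions has infinite order. -/
  infinite_order : ∀ r s : G, IsInvolution r → IsInvolution s → r ≠ s →
    ¬ IsOfFinOrder (r * s)
  /-- (4') Every involution `s ≈_j t` is of the form `t ^ a` with `a ∈ A`. -/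
  equiv_conj : ∀ s : G, IsInvolution s → EquivRel j s t → ∃ a ∈ Cen j, s = conjBy t a
  /-- (5') `Cen (j s) = {1} ∪ {j s' : s' ≈_j s}` for every involution `s ≠ j`. -/
  cen_eq : ∀ s : G, IsInvolution s → s ≠ j →
    (Cen (j * s) : Set G) = {1} ∪ {x | ∃ s' : G, IsInvolution s' ∧ EquivRel j s' s ∧ x = j * s'}
  /-- (6') For every involution `s ∉ A t A`, `s ≠ j`, there is an involution `s' ≈_j s`
  with `Cen (j s) = ⟨j s'⟩`. -/
  cen_cyclic : ∀ s : G, IsInvolution s → s ∉ DoubleCoset.doubleCoset t (Cen j : Set G) (Cen j) →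
    s ≠ j → ∃ s' : G, IsInvolution s' ∧ EquivRel j s' s ∧ Cen (j * s) = Subgroup.zpowers (j * s')

end SharplyTwoTransitive

/-! If `v` lies in `A t A`, it is already an `A`-conjugate of `t` and `G` itself works. Otherwise
(6') gives `Cen (j v) = ⟨b⟩` with `b = j v'`, so `j v = b ^ k` with `k ≠ 0`. By (4') and (5') every
nontrivial element of `Cen (j t)` is conjugate to `j t`, which makes `Cen (j t)` divisible; choose
`a` in it with `a ^ k = j t`. As `j` inverts both `a` and `b`, the subgroups `⟨j, a⟩` and `⟨j, b⟩`
are infinite dihedral, and `G₁` is the HNN extension whose stable letter commutes with `j` and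
conjugates `a` to `b`. It then carries `j t` to `j v`, hence `t` to `v`.

The conditions are checked on the Bass-Serre tree. If the product of two involutions fixes a vertex,
both involutions are conjugate into `G` by one element (`exists_common_conj`). Otherwise it
translates along an axis, and its centralizer is cyclic (`cen_cyclic_of_no_fixed`). This last point,
and the control of centralizers of elements of `G`, rest on acylindricity: an element fixing a path
of length three has square `1`. That holds because `⟨b⟩` is its own centralizer and is not
divisible, whereas `Cen (j t)` is (`isAcylindrical_dihedral`).

Hence every centralizer of a product of two distinct involutions is either cyclic and inverted, or a
conjugate of `Cen (j t)`. Together with (1), (3) and (4'), and with `Cen (j t)` inverted by `j` and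
closed under square roots, this dichotomy yields all the conditions (`conditions_of_dichotomy`). -/

/-! ### Paths without backtracking in trees. -/

namespace TreeAction

/-- `p` restricted to the integer interval `[a, b]` is a path without backtracking. -/
structure IsReduced {V : Type*} (T : SimpleGraph V) (p : ℤ → V) (a b : ℤ) : Prop where
  le : a ≤ b
  adj : ∀ i, a ≤ i → i < b → T.Adj (p i) (p (i + 1))
  ne : ∀ i, a < i → i < b → p (i - 1) ≠ p (i + 1)

/-- A graph is a tree if any two vertices are joined by a path without backtracking, and
paths without backtracking of positive length are never closed. -/
structure IsReducedTree {V : Type*} (T : SimpleGraph V) : Prop where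
  ne_of_lt : ∀ p a b, IsReduced T p a b → a < b → p a ≠ p b
  exists_path : ∀ x y, ∃ (p : ℤ → V) (n : ℕ), IsReduced T p 0 n ∧ p 0 = x ∧ p n = y

namespace IsReduced

variable {V : Type*} {T : SimpleGraph V} {p q : ℤ → V} {a b c : ℤ}

theorem mono (h : IsReduced T p a b) {a' b' : ℤ} (ha : a ≤ a') (hab : a' ≤ b') (hb : b' ≤ b) :
    IsReduced T p a' b' :=
  ⟨hab, fun i h1 h2 => h.adj i (by omega) (by omega), fun i h1 h2 => h.ne i (by omega) (by omega)⟩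

theorem shift (h : IsReduced T p a b) (c : ℤ) :
    IsReduced T (fun i => p (i + c)) (a - c) (b - c) := by
  refine ⟨by have := h.le; omega, fun i h1 h2 => ?_, fun i h1 h2 => ?_⟩
  · have := h.adj (i + c) (by omega) (by omega)
    simpa only [show i + 1 + c = i + c + 1 by ring] using this
  · have := h.ne (i + c) (by omega) (by omega)
    simpa only [show i + 1 + c = i + c + 1 by ring, show i - 1 + c = i + c - 1 by ring] using this

theorem reverse (h : IsReduced T p a b) (c : ℤ) :
    IsReduced T (fun i => p (c - i)) (c - b) (c - a) := by
  refine ⟨by have := h.le; omega, fun i h1 h2 => ?_, fun i h1 h2 => ?_⟩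
  · have := (h.adj (c - (i + 1)) (by omega) (by omega)).symm
    simpa only [show c - (i + 1) + 1 = c - i by ring] using this
  · have := (h.ne (c - i) (by omega) (by omega)).symm
    simpa only [show c - (i + 1) = c - i - 1 by ring, show c - (i - 1) = c - i + 1 by ring]
      using this

/-- Concatenation of paths without backtracking. -/
theorem concat (h : IsReduced T p a b) (h' : IsReduced T q b c) (hb : p b = q b)
    (hne : a < b → b < c → p (b - 1) ≠ q (b + 1)) :
    IsReduced T (fun i => if i ≤ b then p i else q i) a c := by
  have h1 := h.le
  have h2 := h'.le
  refine ⟨by omega, fun i hi hi' => ?_, fun i hi hi' => ?_⟩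
  · rcases lt_trichotomy i b with hib | rfl | hib
    · rw [if_pos (by omega), if_pos (by omega)]
      exact h.adj i hi hib
    · rw [if_pos le_rfl, if_neg (by omega), hb]
      exact h'.adj i le_rfl hi'
    · rw [if_neg (by omega), if_neg (by omega)]
      exact h'.adj i hib.le hi'
  · rcases lt_trichotomy i b with hib | rfl | hib
    · rw [if_pos (by omega), if_pos (by omega)]
      exact h.ne i hi hib
    · rw [if_pos (by omega), if_neg (by omega)]
      exact hne hi hi'
    · rw [if_neg (show ¬ i + 1 ≤ b by omega)]
      split_ifs with hc
      · rw [show i - 1 = b by omega, hb]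
        simpa only [show i - 1 = b by omega] using h'.ne i hib hi'
      · exact h'.ne i hib hi'

end IsReduced

namespace IsReducedTree

variable {V : Type*} {T : SimpleGraph V} {p q : ℤ → V}

theorem path_unique (hT : IsReducedTree T) (n : ℕ) : ∀ {a : ℤ} {m : ℤ},
    IsReduced T p a (a + n) → IsReduced T q a m → p a = q a → p (a + n) = q m →
    m = a + n ∧ ∀ i, a ≤ i → i ≤ a + n → p i = q i := by
  induction n with
  | zero =>
    intro a m hp hq h0 h1
    have hm : m = a := by
      by_contra hne
      have := hq.le
      refine hT.ne_of_lt q a m hq (by omega) ?_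
      rw [← h0, ← h1]; simp
    subst hm
    refine ⟨by simp, fun i hi hi' => ?_⟩
    obtain rfl : i = m := by push_cast at hi'; omega
    exact h0
  | succ n ih =>
    intro a m hp hq h0 h1
    push_cast at hp h1 ⊢
    have hm : a < m := by
      by_contra hne
      have := hq.le
      obtain rfl : m = a := by omega
      refine hT.ne_of_lt p _ _ hp (by omega) ?_
      rw [h0, h1]
    -- If the first steps differed, `p` reversed followed by `q` would be a closed path without
    -- backtracking.
    have hstep : p (a + 1) = q (a + 1) := by
      by_contra hne
      have hr := (hp.reverse (2 * a)).mono (a' := 2 * a - (a + (n + 1))) (b' := a) le_rfl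
        (by omega) (by omega)
      have hc := hr.concat hq (by simpa only [show 2 * a - a = a by ring] using h0)
        (fun _ _ => by simpa only [show 2 * a - (a - 1) = a + 1 by ring] using hne)
      refine hT.ne_of_lt _ _ _ hc (by omega) ?_
      rw [if_pos (by omega), if_neg (by omega), ← h1]
      congr 1; ring
    obtain ⟨h2, h3⟩ := ih (a := a + 1) (m := m)
      ((hp.mono (by omega) (by omega) le_rfl).mono le_rfl (by omega) (by omega))
      (hq.mono (by omega) (by omega) le_rfl) hstep
      (by rw [← h1]; congr 1; ring)
    refine ⟨by omega, fun i hi hi' => ?_⟩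
    rcases eq_or_lt_of_le hi with rfl | hi
    · exact h0
    · exact h3 i (by omega) (by omega)

theorem path_unique' (hT : IsReducedTree T) {a b m : ℤ} (hp : IsReduced T p a b)
    (hq : IsReduced T q a m) (h0 : p a = q a) (h1 : p b = q m) :
    m = b ∧ ∀ i, a ≤ i → i ≤ b → p i = q i := by
  obtain ⟨n, rfl⟩ : ∃ n : ℕ, b = a + n := ⟨(b - a).toNat, by have := hp.le; omega⟩
  exact hT.path_unique n hp hq h0 h1

end IsReducedTree

/-! ### Group actions on trees: fixed vertices and translation axes. -/

section Action

variable {V : Type*} {T : SimpleGraph V} {Γ : Type*} [Group Γ] [MulAction Γ V]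
  {p q : ℤ → V}

theorem IsReduced.smul (hadj : ∀ (g : Γ) x y, T.Adj x y → T.Adj (g • x) (g • y)) {a b : ℤ}
    (h : IsReduced T p a b) (g : Γ) : IsReduced T (fun i => g • p i) a b :=
  ⟨h.le, fun i h1 h2 => hadj g _ _ (h.adj i h1 h2),
    fun i h1 h2 h3 => h.ne i h1 h2 (MulAction.injective g h3)⟩

theorem fixes_path (hT : IsReducedTree T)
    (hadj : ∀ (g : Γ) x y, T.Adj x y → T.Adj (g • x) (g • y)) {a b : ℤ}
    (h : IsReduced T p a b) {g : Γ} (ha : g • p a = p a) (hb : g • p b = p b) :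
    ∀ i, a ≤ i → i ≤ b → g • p i = p i :=
  (hT.path_unique' (h.smul hadj g) h ha hb).2

/-- An involution inverting `h` has a common fixed vertex with `h` as soon as `h` has a fixed
vertex. -/
theorem exists_common_fixed (hT : IsReducedTree T)
    (hadj : ∀ (g : Γ) x y, T.Adj x y → T.Adj (g • x) (g • y))
    (hinv : ∀ (g : Γ) x y, T.Adj x y → g • x = y → g • y ≠ x)
    {j h : Γ} (hj : j * j = 1) (hjh : h * j = j * h⁻¹) {x : V} (hx : h • x = x) :
    ∃ y : V, h • y = y ∧ j • y = y := by
  obtain ⟨p, n, hp, h0, h1⟩ := hT.exists_path x (j • x)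
  have hx' : h⁻¹ • x = x := by rw [inv_smul_eq_iff, hx]
  have hfix := fixes_path hT hadj hp (g := h) (by rw [h0, hx])
    (by rw [h1, ← mul_smul, hjh, mul_smul, hx'])
  -- Since `j` swaps `x` and `j • x`, it reverses the path between them. The midpoint is the
  -- required vertex; for odd length the middle edge would be inverted.
  have hrev : ∀ i : ℤ, 0 ≤ i → i ≤ n → j • p i = p (n - i) := by
    have hq := hp.reverse n
    rw [sub_self, sub_zero] at hq
    exact (hT.path_unique' (hp.smul hadj j) hq (by simp [h0, h1])
      (by simp [h1, h0, ← mul_smul, hj])).2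
  rcases Nat.even_or_odd' n with ⟨m, rfl | rfl⟩
  · refine ⟨p m, hfix m (by omega) (by push_cast; omega), ?_⟩
    rw [hrev m (by omega) (by push_cast; omega)]
    congr 1; push_cast; ring
  · exfalso
    push_cast at hp hrev
    refine hinv j (p m) (p (m + 1)) (hp.adj m (by omega) (by omega)) ?_ ?_
    · rw [hrev m (by omega) (by omega)]; congr 1; ring
    · rw [hrev (m + 1) (by omega) (by omega)]; congr 1; ring

/-- A translation axis for `h`. -/
structure IsAxis (T : SimpleGraph V) (h : Γ) (n : ℕ) (L : ℤ → V) : Prop where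
  adj : ∀ i, T.Adj (L i) (L (i + 1))
  ne : ∀ i, L (i - 1) ≠ L (i + 1)
  smul : ∀ i, h • L i = L (i + n)

theorem IsAxis.isReduced {h : Γ} {n : ℕ} {L : ℤ → V} (hL : IsAxis T h n L) {a b : ℤ}
    (hab : a ≤ b) : IsReduced T L a b :=
  ⟨hab, fun i _ _ => hL.adj i, fun i _ _ => hL.ne i⟩

theorem IsAxis.injective (hT : IsReducedTree T) {h : Γ} {n : ℕ} {L : ℤ → V}
    (hL : IsAxis T h n L) : Function.Injective L := by
  intro a b hab
  rcases lt_trichotomy a b with h1 | h1 | h1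
  · exact absurd hab (hT.ne_of_lt L a b (hL.isReduced h1.le) h1)
  · exact h1
  · exact absurd hab.symm (hT.ne_of_lt L b a (hL.isReduced h1.le) h1)

theorem IsAxis.pow_smul {h : Γ} {n : ℕ} {L : ℤ → V} (hL : IsAxis T h n L) (k : ℕ) (i : ℤ) :
    h ^ k • L i = L (i + k * n) := by
  induction k generalizing i with
  | zero => simp
  | succ k ih =>
    rw [pow_succ, mul_smul, hL.smul, ih]
    congr 1; push_cast; ring

theorem IsAxis.smul_of_commute {h x : Γ} {n : ℕ} {L : ℤ → V}
    (hadj : ∀ (g : Γ) x y, T.Adj x y → T.Adj (g • x) (g • y))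
    (hL : IsAxis T h n L) (hx : h * x = x * h) : IsAxis T h n (fun i => x • L i) :=
  ⟨fun i => hadj x _ _ (hL.adj i), fun i e => hL.ne i (MulAction.injective x e),
    fun i => by rw [← mul_smul, hx, mul_smul, hL.smul]⟩

theorem IsAxis.smul_of_invert {h x : Γ} {n : ℕ} {L : ℤ → V}
    (hadj : ∀ (g : Γ) x y, T.Adj x y → T.Adj (g • x) (g • y))
    (hL : IsAxis T h n L) (hx : h * x = x * h⁻¹) : IsAxis T h n (fun i => x • L (-i)) := by
  refine ⟨fun i => hadj x _ _ ?_, fun i e => hL.ne (-i) ?_, fun i => ?_⟩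
  · simpa only [show -(i + 1) + 1 = -i by ring] using (hL.adj (-(i + 1))).symm
  · have := MulAction.injective x e
    simpa only [show -(i - 1) = -i + 1 by ring, show -(i + 1) = -i - 1 by ring] using this.symm
  · rw [← mul_smul, hx, mul_smul]
    congr 1
    rw [inv_smul_eq_iff, hL.smul]
    congr 1; ring

theorem IsAxis.not_isOfFinOrder (hT : IsReducedTree T) {h : Γ} {n : ℕ} (hn : n ≠ 0) {L : ℤ → V}
    (hL : IsAxis T h n L) : ¬ IsOfFinOrder h := by
  rw [isOfFinOrder_iff_pow_eq_one]
  rintro ⟨k, hk, he⟩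
  have h1 := hL.pow_smul k 0
  rw [he, one_smul] at h1
  have h2 := hL.injective hT h1
  have : (k : ℤ) * n = 0 := by omega
  rcases mul_eq_zero.1 this with h3 | h3 <;> omega

/-- An automorphism without fixed vertices and without inversions has a translation axis. -/
theorem exists_isAxis (hT : IsReducedTree T)
    (hadj : ∀ (g : Γ) x y, T.Adj x y → T.Adj (g • x) (g • y))
    (hinv : ∀ (g : Γ) x y, T.Adj x y → g • x = y → g • y ≠ x)
    {h : Γ} (hfix : ∀ x : V, h • x ≠ x) [Nonempty V] :
    ∃ (n : ℕ) (L : ℤ → V), n ≠ 0 ∧ IsAxis T h n L := by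
  classical
  -- The axis is glued from the `h`-translates of a path realizing the minimal displacement.
  have hex : ∃ n : ℕ, ∃ p : ℤ → V, IsReduced T p 0 n ∧ h • p 0 = p n := by
    obtain ⟨x⟩ := ‹Nonempty V›
    obtain ⟨p, n, hp, h0, h1⟩ := hT.exists_path x (h • x)
    exact ⟨n, p, hp, by rw [h0, h1]⟩
  obtain ⟨p, hp, hp1⟩ := Nat.find_spec hex
  have hmin : ∀ m < Nat.find hex, ∀ q : ℤ → V, IsReduced T q 0 m → h • q 0 ≠ q m :=
    fun m hm q hq e => Nat.find_min hex hm ⟨q, hq, e⟩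
  generalize Nat.find hex = n at hp hp1 hmin
  have hn : n ≠ 0 := by
    rintro rfl
    exact hfix (p 0) (by simpa using hp1)
  have hn0 : (n : ℤ) ≠ 0 := by exact_mod_cast hn
  have hnpos : (0 : ℤ) < n := by omega
  let L : ℤ → V := fun k => h ^ (k / n) • p (k % n)
  have hL0 : ∀ k : ℤ, 0 ≤ k → k ≤ n → L k = p k := by
    intro k h1 h2
    rcases eq_or_lt_of_le h2 with rfl | h2
    · simp only [L, Int.ediv_self hn0, Int.emod_self, zpow_one, hp1]
    · simp only [L, Int.ediv_eq_zero_of_lt h1 h2, Int.emod_eq_of_lt h1 h2, zpow_zero, one_smul]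
  have hLs : ∀ (m k : ℤ), h ^ m • L k = L (k + n * m) := by
    intro m k
    simp only [L, Int.add_mul_ediv_left _ _ hn0, Int.add_mul_emod_self_left, ← mul_smul,
      ← zpow_add, add_comm m]
  have hLn : ∀ k, L (k + n) = h • L k := fun k => by simpa using (hLs 1 k).symm
  refine ⟨n, L, hn, fun i => ?_, fun i => ?_, fun i => (hLn i).symm⟩
  · have h1 := Int.emod_nonneg i hn0
    have h2 := Int.emod_lt_of_pos i hnpos
    have h3 := Int.emod_add_mul_ediv i n
    have h4 : T.Adj (L (i % n)) (L (i % n + 1)) := by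
      rw [hL0 _ h1 h2.le, hL0 _ (by omega) (by omega)]
      exact hp.adj _ h1 h2
    have h5 := hadj (h ^ (i / n)) _ _ h4
    rw [hLs, hLs, show i % n + 1 + n * (i / n) = i % n + n * (i / n) + 1 by ring, h3] at h5
    exact h5
  · have h1 := Int.emod_nonneg (i - 1) hn0
    have h2 := Int.emod_lt_of_pos (i - 1) hnpos
    have h3 := Int.emod_add_mul_ediv (i - 1) n
    have h4 : L ((i - 1) % n) ≠ L ((i - 1) % n + 2) := by
      generalize (i - 1) % (n : ℤ) = r at h1 h2
      rw [hL0 r h1 h2.le]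
      rcases lt_or_ge (r + 1) n with hr | hr
      · rw [hL0 _ (by omega) (by omega)]
        simpa only [add_sub_cancel_right, show r + 1 + 1 = r + 2 by ring] using
          hp.ne (r + 1) (by omega) hr
      · obtain rfl : r = n - 1 := by omega
        -- A backtrack at a junction means `h • p 1 = p (n - 1)`: a displacement of `n - 2`, or for
        -- `n = 1` an inverted edge.
        rw [show (n : ℤ) - 1 + 2 = 1 + n by ring, hLn, hL0 1 (by omega) (by omega)]
        intro he
        rcases Nat.lt_or_ge 1 n with h6 | h6
        · have h7 := (hp.mono (a' := 1) (b' := n - 1) (by omega) (by omega) (by omega)).shift 1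
          rw [sub_self, show (n : ℤ) - 1 - 1 = ((n - 2 : ℕ) : ℤ) by omega] at h7
          refine hmin _ (by omega) _ h7 ?_
          rw [zero_add, ← he]
          congr 1; omega
        · obtain rfl : n = 1 := by omega
          refine hinv h (p 0) (p 1) (hp.adj 0 le_rfl (by simp)) (by simpa using hp1) ?_
          rw [← he]; simp
    intro he
    apply h4
    have h5 : h ^ ((i - 1) / n) • L ((i - 1) % n) = h ^ ((i - 1) / n) • L ((i - 1) % n + 2) := by
      rw [hLs, hLs, show (i - 1) % n + 2 + n * ((i - 1) / n)
        = (i - 1) % n + n * ((i - 1) / n) + 2 by ring, h3, he]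
      congr 1; ring
    exact MulAction.injective _ h5

/-- Take a shortest path from `M 0` to `L`, of length `m`. If `m > 0`, following it, then `n` steps
of `L`, then the `h`-image of the path backwards gives a reduced path of length `2m + n` from `M 0`
to `h • M 0`, while `M` provides one of length `n`. -/
theorem IsAxis.exists_eq (hT : IsReducedTree T)
    (hadj : ∀ (g : Γ) x y, T.Adj x y → T.Adj (g • x) (g • y))
    {h : Γ} {n : ℕ} (hn : n ≠ 0) {L M : ℤ → V}
    (hL : IsAxis T h n L) (hM : IsAxis T h n M) : ∃ c, M 0 = L c := by
  classical
  have hex : ∃ m : ℕ, ∃ (q : ℤ → V) (k : ℤ), IsReduced T q 0 m ∧ q 0 = M 0 ∧ q m = L k := by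
    obtain ⟨p, m, hp, h0, h1⟩ := hT.exists_path (M 0) (L 0)
    exact ⟨m, p, 0, hp, h0, h1⟩
  obtain ⟨q, k, hq, hq0, hqm⟩ := Nat.find_spec hex
  have hmin : ∀ l < Nat.find hex, ∀ (q : ℤ → V) (k : ℤ), IsReduced T q 0 l → q 0 = M 0 →
      q l ≠ L k := fun l hl q k h1 h2 h3 => Nat.find_min hex hl ⟨q, k, h1, h2, h3⟩
  generalize Nat.find hex = m at hq hqm hmin
  rcases Nat.eq_zero_or_pos m with rfl | hm
  · exact ⟨k, by rw [← hq0, ← hqm]; simp⟩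
  exfalso
  have hlast : ∀ k', q (m - 1) ≠ L k' := by
    intro k'
    have := hmin (m - 1) (by omega) q k' (hq.mono le_rfl (by omega) (by omega)) hq0
    rwa [show ((m - 1 : ℕ) : ℤ) = m - 1 by omega] at this
  have h1 : IsReduced T q 0 m := hq
  have h2 : IsReduced T (fun i => L (i + (k - m))) m (m + n) := by
    simpa only [show k - (k - m) = (m : ℤ) by ring, show k + n - (k - m) = (m + n : ℤ) by ring]
      using (hL.isReduced (a := k) (b := k + n) (by omega)).shift (k - m)
  have h3 : IsReduced T (fun i => h • q (2 * m + n - i)) (m + n) (2 * m + n) := by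
    simpa only [show (2 * m + n - m : ℤ) = m + n by ring, sub_zero] using
      (hq.smul hadj h).reverse (2 * m + n)
  have h12 := h1.concat h2 (by simp only [hqm]; congr 1; ring) (fun _ _ => hlast _)
  have h123 := h12.concat h3
    (by
      rw [if_neg (by omega), show (2 * m + n - (m + n) : ℤ) = m by ring, hqm, hL.smul]
      congr 1; ring)
    (fun _ _ => by
      rw [show (2 * m + n - (m + n + 1) : ℤ) = m - 1 by ring]
      have key : ∀ k', L k' ≠ h • q (m - 1) := by
        intro k' e
        refine hlast (k' - n) (MulAction.injective h ?_)
        beta_reduce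
        rw [hL.smul, ← e]
        congr 1; ring
      split_ifs with hc
      · rw [show (m + n - 1 : ℤ) = m by omega, hqm]; exact key k
      · exact key _)
  have h4 : IsReduced T M 0 n := hM.isReduced (by omega)
  have := (hT.path_unique' h4 h123 (by
      rw [if_pos (by omega), if_pos (by omega), hq0])
    (by
      rw [if_neg (by omega), sub_self, hq0, hM.smul, zero_add])).1
  omega

/-- The translation axis is unique up to reparametrization. -/
theorem IsAxis.eq_shift (hT : IsReducedTree T)
    (hadj : ∀ (g : Γ) x y, T.Adj x y → T.Adj (g • x) (g • y))
    {h : Γ} {n : ℕ} (hn : n ≠ 0) {L M : ℤ → V}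
    (hL : IsAxis T h n L) (hM : IsAxis T h n M) : ∃ c, ∀ i, M i = L (i + c) := by
  obtain ⟨c, hc⟩ := hL.exists_eq hT hadj hn hM
  refine ⟨c, fun i => ?_⟩
  have hnpos : (1 : ℤ) ≤ n := by omega
  -- `L` and `M` agree up to the shift at all multiples of `n`.
  have hmul : ∀ k : ℕ, M (k * n) = L (k * n + c) := by
    intro k
    have h1 := hM.pow_smul k 0
    rw [zero_add, hc, hL.pow_smul] at h1
    rw [← h1, add_comm]
  have hmul' : ∀ k : ℕ, M (-(k * n)) = L (-(k * n) + c) := by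
    intro k
    have h1 := hM.pow_smul k (-(k * n))
    have h2 := hL.pow_smul k (-(k * n) + c)
    refine MulAction.injective (h ^ k) ?_
    dsimp only
    rw [h1, h2, neg_add_cancel, hc]
    congr 1; ring
  have hk : |i| ≤ (i.natAbs : ℤ) * n := by
    rw [Int.natCast_natAbs]
    exact le_mul_of_one_le_right (abs_nonneg i) hnpos
  have hk' := abs_le.1 hk
  have h1 : IsReduced T M (-((i.natAbs : ℤ) * n)) (i.natAbs * n) := hM.isReduced (by omega)
  have h2 : IsReduced T (fun k => L (k + c)) (-((i.natAbs : ℤ) * n)) (i.natAbs * n) := by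
    simpa only [add_sub_cancel_right] using
      (hL.isReduced (a := -((i.natAbs : ℤ) * n) + c) (b := i.natAbs * n + c) (by omega)).shift c
  exact (hT.path_unique' h1 h2 (hmul' _) (hmul _)).2 i (by omega) (by omega)

end Action

end TreeAction

namespace SharplyTwoTransitive

/-! ### Involutions and centralizers. -/

section Involutions

variable {K : Type u} [Group K]

theorem isInvolution_iff {s : K} : IsInvolution s ↔ s * s = 1 ∧ s ≠ 1 := by
  rw [IsInvolution, orderOf_eq_prime_iff, pow_two]

theorem IsInvolution.mul_self {s : K} (hs : IsInvolution s) : s * s = 1 := (isInvolution_iff.1 hs).1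

theorem IsInvolution.inv_eq {s : K} (hs : IsInvolution s) : s⁻¹ = s :=
  inv_eq_of_mul_eq_one_left hs.mul_self

theorem IsInvolution.mul_mul_cancel {s : K} (hs : IsInvolution s) (x : K) : s * (s * x) = x := by
  rw [← mul_assoc, hs.mul_self, one_mul]

theorem IsInvolution.mul_mul_cancel_right {s : K} (hs : IsInvolution s) (x : K) :
    x * s * s = x := by
  rw [mul_assoc, hs.mul_self, mul_one]

theorem IsInvolution.map {K' : Type*} [Group K'] {s : K} (hs : IsInvolution s) (f : K →* K')
    (hf : Function.Injective f) : IsInvolution (f s) :=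
  (orderOf_injective f hf s).trans hs

theorem isInvolution_map_iff {K' : Type*} [Group K'] {s : K} (f : K →* K')
    (hf : Function.Injective f) : IsInvolution (f s) ↔ IsInvolution s := by
  rw [IsInvolution, IsInvolution, orderOf_injective f hf s]

theorem IsInvolution.conj {s : K} (hs : IsInvolution s) (g : K) : IsInvolution (g * s * g⁻¹) :=
  hs.map (MulAut.conj g).toMonoidHom (MulAut.conj g).injective

theorem IsInvolution.conj' {s : K} (hs : IsInvolution s) (g : K) : IsInvolution (g⁻¹ * s * g) := by
  simpa using hs.conj g⁻¹

theorem mem_cen {x g : K} : x ∈ Cen g ↔ x * g = g * x := by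
  rw [Cen, Subgroup.mem_centralizer_singleton_iff]

theorem self_mem_cen (g : K) : g ∈ Cen g := mem_cen.2 rfl

/-- `x` centralizes `a g a⁻¹` if and only if `a⁻¹ x a` centralizes `g`. -/
theorem mem_cen_conj {x g a : K} : x ∈ Cen (a * g * a⁻¹) ↔ a⁻¹ * x * a ∈ Cen g := by
  rw [mem_cen, mem_cen, ← mul_right_inj a⁻¹, ← mul_left_inj a]
  simp only [mul_assoc, inv_mul_cancel_left, inv_mul_cancel, mul_one]

/-- The elements of a subgroup inverted by an involution commute. -/
theorem mul_comm_of_inverted {H : Subgroup K} {j : K} (hj : j * j = 1)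
    (hH : ∀ c ∈ H, j * c * j = c⁻¹) {c d : K} (hc : c ∈ H) (hd : d ∈ H) : c * d = d * c := by
  have h1 := hH _ (mul_mem hc hd)
  have h2 : j * (c * d) * j = (j * c * j) * (j * d * j) := by
    have : (j * c * j) * (j * d * j) = j * c * (j * j) * d * j := by group
    rw [this, hj]; group
  rw [h2, hH c hc, hH d hd, ← mul_inv_rev, inv_inj] at h1
  exact h1.symm

theorem mul_mul_self_of_involutions {i k : K} (hi : IsInvolution i) (hk : IsInvolution k) :
    i * (i * k) * i = (i * k)⁻¹ := by
  rw [hi.mul_mul_cancel, mul_inv_rev, hi.inv_eq, hk.inv_eq]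

theorem IsInvolution.mul_ne_one {i k : K} (hi : IsInvolution i) (hik : i ≠ k) : i * k ≠ 1 :=
  fun h => hik (by rw [← hi.mul_mul_cancel k, h, mul_one])

/-- An element inverted by the involution `i` is a product of `i` with an involution. -/
theorem isInvolution_mul_of_inverted {i x : K} (hi : IsInvolution i)
    (hx : i * x * i = x⁻¹) (hne : x ≠ i) : IsInvolution (i * x) := by
  refine isInvolution_iff.2 ⟨?_, fun h => hne ?_⟩
  · rw [← mul_assoc, hx, inv_mul_cancel]
  · rw [← hi.mul_mul_cancel x, h, mul_one]

theorem eq_of_commute (h3 : ∀ r s : K, IsInvolution r → IsInvolution s → r ≠ s →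
    ¬ IsOfFinOrder (r * s)) {r s : K} (hr : IsInvolution r) (hs : IsInvolution s)
    (h : r * s = s * r) : r = s := by
  by_contra hne
  refine h3 r s hr hs hne (isOfFinOrder_iff_pow_eq_one.2 ⟨2, two_pos, ?_⟩)
  rw [pow_two]
  nth_rw 2 [h]
  rw [← mul_assoc, hs.mul_mul_cancel_right, hr.mul_self]

end Involutions

/-! ### The centralizer dichotomy and the conditions it implies. -/

section Dichotomy

variable {K : Type u} [Group K]

/-- The centralizer of `i k` is either cyclic and inverted by `i`, or a conjugate of `C`. -/
def CenDichotomy (C : Subgroup K) (i k : K) : Prop :=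
  (∃ z, Cen (i * k) = Subgroup.zpowers z ∧ i * z * i = z⁻¹) ∨
    ∃ a, ∀ x, x ∈ Cen (i * k) ↔ a⁻¹ * x * a ∈ C

theorem CenDichotomy.conj {C : Subgroup K} {i k : K} (h : CenDichotomy C i k) (w : K) :
    CenDichotomy C (w * i * w⁻¹) (w * k * w⁻¹) := by
  have hik : w * i * w⁻¹ * (w * k * w⁻¹) = w * (i * k) * w⁻¹ := by group
  rcases h with ⟨z, hz, hz'⟩ | ⟨a, ha⟩
  · refine Or.inl ⟨w * z * w⁻¹, ?_, ?_⟩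
    · ext x
      rw [hik, mem_cen_conj, hz, Subgroup.mem_zpowers_iff, Subgroup.mem_zpowers_iff]
      refine exists_congr fun n => ?_
      rw [conj_zpow]
      constructor
      · intro h; rw [h]; group
      · intro h; rw [← h]; group
    · have : w * i * w⁻¹ * (w * z * w⁻¹) * (w * i * w⁻¹) = w * (i * z * i) * w⁻¹ := by group
      rw [this, hz']; group
  · refine Or.inr ⟨w * a, fun x => ?_⟩
    rw [hik, mem_cen_conj, ha]
    have : a⁻¹ * (w⁻¹ * x * w) * a = (w * a)⁻¹ * x * (w * a) := by group
    rw [this]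

theorem inverted_of_mem_zpowers {i z x : K} (hi : i * i = 1) (hz : i * z * i = z⁻¹)
    (hx : x ∈ Subgroup.zpowers z) : i * x * i = x⁻¹ := by
  obtain ⟨n, rfl⟩ := Subgroup.mem_zpowers_iff.1 hx
  have hi' : i⁻¹ = i := inv_eq_of_mul_eq_one_left hi
  calc i * z ^ n * i = i * z ^ n * i⁻¹ := by rw [hi']
    _ = (i * z * i⁻¹) ^ n := (conj_zpow ..).symm
    _ = (z ^ n)⁻¹ := by rw [hi', hz, inv_zpow]

variable {j t : K}

/-- The product of two involutions inverting `h` centralizes `h`. -/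
theorem commute_of_invert {i q h : K} (hi : IsInvolution i) (hq : IsInvolution q)
    (h1 : i * h * i = h⁻¹) (h2 : q * h * q = h⁻¹) : i * q * h = h * (i * q) := by
  have h3 : q * h = h⁻¹ * q := by rw [← h2, hq.mul_mul_cancel_right]
  have h4 : i * h⁻¹ = h * i := by
    rw [← h1, ← mul_assoc, ← mul_assoc, hi.mul_self, one_mul]
  rw [mul_assoc, h3, ← mul_assoc, h4, mul_assoc]

/-- Both `i` and `a j a⁻¹` invert `i k`, so their product centralizes it. -/
theorem CenDichotomy.mul_conj_mem {i k : K} (hj : IsInvolution j)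
    (hC : ∀ c ∈ Cen (j * t), j * c * j = c⁻¹) (hi : IsInvolution i) (hk : IsInvolution k)
    {a : K} (ha : ∀ x, x ∈ Cen (i * k) ↔ a⁻¹ * x * a ∈ Cen (j * t)) :
    i * (a * j * a⁻¹) ∈ Cen (i * k) := by
  refine mem_cen.2 (commute_of_invert hi (hj.conj a) (mul_mul_self_of_involutions hi hk) ?_)
  have h1 := hC _ ((ha _).1 (self_mem_cen (i * k)))
  have : a * j * a⁻¹ * (i * k) * (a * j * a⁻¹) = a * (j * (a⁻¹ * (i * k) * a) * j) * a⁻¹ := by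
    group
  rw [this, h1]; group

/-- In the second case put `q = a j a⁻¹`. The centralizer is abelian, is inverted by `q` and
contains `i q`; hence conjugation by `i` and by `q` agree on it. -/
theorem CenDichotomy.inverted {i k : K} (hj : IsInvolution j)
    (hC : ∀ c ∈ Cen (j * t), j * c * j = c⁻¹) (hi : IsInvolution i) (hk : IsInvolution k)
    (h : CenDichotomy (Cen (j * t)) i k) {x : K} (hx : x ∈ Cen (i * k)) :
    i * x * i = x⁻¹ := by
  rcases h with ⟨z, hz, hz'⟩ | ⟨a, ha⟩
  · rw [hz] at hx
    exact inverted_of_mem_zpowers hi.mul_self hz' hx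
  · have h1 := (ha _).1 (CenDichotomy.mul_conj_mem hj hC hi hk ha)
    have h2 := (ha _).1 hx
    have h3 := mul_comm_of_inverted hj.mul_self hC h1 h2
    have h4 : i * (a * j * a⁻¹) * x = x * (i * (a * j * a⁻¹)) := by
      have : a * (a⁻¹ * (i * (a * j * a⁻¹)) * a * (a⁻¹ * x * a)) * a⁻¹ =
          i * (a * j * a⁻¹) * x := by group
      rw [← this, h3]; group
    have h5 : (a * j * a⁻¹) * x * (a * j * a⁻¹) = x⁻¹ := by
      have : a * j * a⁻¹ * x * (a * j * a⁻¹) = a * (j * (a⁻¹ * x * a) * j) * a⁻¹ := by group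
      rw [this, hC _ h2]; group
    have hq := hj.conj a
    generalize a * j * a⁻¹ = q at h4 h5 hq
    calc i * x * i = i * (x * (i * q)) * q := by
          rw [← mul_assoc x, ← mul_assoc i, hq.mul_mul_cancel_right, mul_assoc]
      _ = i * i * (q * x * q) := by rw [← h4]; group
      _ = x⁻¹ := by rw [h5, hi.mul_self, one_mul]

/-- Nontrivial elements of the centralizer of a product of two involutions have the same
centralizer, provided such centralizers are inverted. -/
theorem cen_eq_of_mem
    (h3 : ∀ r s : K, IsInvolution r → IsInvolution s → r ≠ s → ¬ IsOfFinOrder (r * s))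
    (hinv : ∀ i k : K, IsInvolution i → IsInvolution k → i ≠ k → ∀ x ∈ Cen (i * k),
      i * x * i = x⁻¹)
    {i k x : K} (hi : IsInvolution i) (hk : IsInvolution k) (hik : i ≠ k)
    (hx : x ∈ Cen (i * k)) (hx1 : x ≠ 1) : IsInvolution (i * x) ∧ Cen x = Cen (i * k) := by
  have hxi : x ≠ i := by
    rintro rfl
    rw [mem_cen, mul_assoc, mul_right_inj] at hx
    exact hik (eq_of_commute h3 hi hk hx)
  have h1 := isInvolution_mul_of_inverted hi (hinv i k hi hk hik x hx) hxi
  have h2 : i ≠ i * x := fun h => hx1 (by simpa using h.symm)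
  have hab : ∀ {k c d}, IsInvolution k → i ≠ k → c ∈ Cen (i * k) → d ∈ Cen (i * k) →
      c * d = d * c := fun hk hik hc hd =>
    mul_comm_of_inverted hi.mul_self (fun c hc => hinv i _ hi hk hik c hc) hc hd
  refine ⟨h1, ?_⟩
  have hxx : i * (i * x) = x := hi.mul_mul_cancel x
  have hik' : i * k ∈ Cen x := mem_cen.2 (mem_cen.1 hx).symm
  ext y
  constructor
  · intro hy
    refine mem_cen.2 (hab h1 h2 ?_ ?_) <;> rwa [hxx]
  · intro hy
    exact mem_cen.2 (hab hk hik hy hx)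

/-- The dichotomy makes every `Cen (i * k)` inverted by `i`, hence abelian. Malnormality and (5')
follow from this alone; (6') also needs square roots in `Cen (j * t)`. -/
theorem conditions_of_dichotomy (hj : IsInvolution j) (ht : IsInvolution t) (hjt : j ≠ t)
    (h1 : ∀ r s : K, IsInvolution r → IsInvolution s → ∃ g : K, conjBy r g = s)
    (h3 : ∀ r s : K, IsInvolution r → IsInvolution s → r ≠ s → ¬ IsOfFinOrder (r * s))
    (h4 : ∀ s : K, IsInvolution s → EquivRel j s t → ∃ a ∈ Cen j, s = conjBy t a)
    (hC : ∀ c ∈ Cen (j * t), j * c * j = c⁻¹)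
    (hsq : ∀ c ∈ Cen (j * t), ∃ w ∈ Cen (j * t), w * w = c)
    (hD : ∀ i k : K, IsInvolution i → IsInvolution k → i ≠ k → CenDichotomy (Cen (j * t)) i k) :
    Conditions j t := by
  have hinv : ∀ i k : K, IsInvolution i → IsInvolution k → i ≠ k → ∀ x ∈ Cen (i * k),
      i * x * i = x⁻¹ := fun i k hi hk hik x hx =>
    (hD i k hi hk hik).inverted hj hC hi hk hx
  refine ⟨h1, ?_, h3, h4, ?_, ?_⟩
  · intro g hg a ha hag
    by_contra ha1
    have hi : IsInvolution (g * j * g⁻¹) := hj.conj g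
    have hia : a ∈ Cen (g * j * g⁻¹) := mem_cen_conj.2 hag
    have hji : j ≠ g * j * g⁻¹ := fun h => hg (mem_cen.2 (by
      nth_rw 2 [h]; group))
    rw [mem_cen] at ha hia
    -- Commuting with both involutions, `a` is inverted by `j` as well as centralized by it. So `a`
    -- is an involution, and by (3) it equals both of them.
    have haji : a ∈ Cen (j * (g * j * g⁻¹)) := by
      rw [mem_cen, ← mul_assoc, ha, mul_assoc, hia, ← mul_assoc]
    have h5 := hinv _ _ hj hi hji a haji
    rw [← ha, hj.mul_mul_cancel_right] at h5
    have ha2 : IsInvolution a := isInvolution_iff.2 ⟨by nth_rw 1 [h5]; simp, ha1⟩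
    exact hji ((eq_of_commute h3 ha2 hj ha).symm.trans (eq_of_commute h3 ha2 hi hia))
  · intro s hs hsj
    ext x
    constructor
    · intro hx
      by_cases hx1 : x = 1
      · exact Or.inl hx1
      · obtain ⟨h5, h6⟩ := cen_eq_of_mem h3 hinv hj hs hsj.symm hx hx1
        refine Or.inr ⟨j * x, h5, ?_, (hj.mul_mul_cancel x).symm⟩
        rw [EquivRel, hj.mul_mul_cancel, h6]
    · rintro (hx | ⟨s', -, h5, rfl⟩)
      · rw [Set.mem_singleton_iff.1 hx]
        exact one_mem _
      · rw [EquivRel] at h5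
        rw [← h5]
        exact self_mem_cen _
  · intro s hs hsA hsj
    rcases hD j s hj hs hsj.symm with ⟨z, hz, hz'⟩ | ⟨a, ha⟩
    · have hzm : z ∈ Cen (j * s) := by rw [hz]; exact Subgroup.mem_zpowers z
      have hz1 : z ≠ 1 := by
        rintro rfl
        have := self_mem_cen (j * s)
        rw [hz, Subgroup.zpowers_one_eq_bot, Subgroup.mem_bot] at this
        exact hj.mul_ne_one hsj.symm this
      obtain ⟨h5, h6⟩ := cen_eq_of_mem h3 hinv hj hs hsj.symm hzm hz1
      refine ⟨j * z, h5, ?_, ?_⟩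
      · rw [EquivRel, hj.mul_mul_cancel, h6]
      · rw [hj.mul_mul_cancel, hz]
    · exfalso
      -- The conjugator `a` can be moved into `Cen j`: if `w ^ 2 = a⁻¹ j a j`, with `j` inverting
      -- `w`, then `a w` centralizes `j`. Conjugating `s` by `a w` gives an involution equivalent to
      -- `t`, and (4') puts `s` in `A t A`.
      obtain ⟨w, hw, hww⟩ := hsq _ ((ha _).1 (CenDichotomy.mul_conj_mem hj hC hj hs ha))
      have hwj : w * j = j * w⁻¹ := by
        rw [← hC w hw, ← mul_assoc, ← mul_assoc, hj.mul_self, one_mul]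
      have hb : (a * w) * j * (a * w)⁻¹ = j := by
        have h5 : j = a * (w * w) * j * a⁻¹ := by
          rw [hww]
          have : a * (a⁻¹ * (j * (a * j * a⁻¹)) * a) * j * a⁻¹ = j * a * (j * j) * a⁻¹ := by group
          rw [this, hj.mul_self]; group
        have h6 : a * w * j * (a * w)⁻¹ = a * (w * (j * w⁻¹)) * a⁻¹ := by group
        rw [h6, ← hwj]
        nth_rw 2 [h5]
        group
      have hbA : a * w ∈ Cen j := mem_cen.2 (by nth_rw 2 [← hb]; group)
      have hbs : j * ((a * w)⁻¹ * s * (a * w)) ∈ Cen (j * t) := by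
        have h5 : j * ((a * w)⁻¹ * s * (a * w)) = w⁻¹ * (a⁻¹ * (j * s) * a) * w := by
          have : j * (a * w)⁻¹ = (a * w)⁻¹ * j := (mem_cen.1 (inv_mem hbA)).symm
          calc j * ((a * w)⁻¹ * s * (a * w)) = j * (a * w)⁻¹ * s * (a * w) := by group
            _ = _ := by rw [this]; group
        rw [h5]
        exact mul_mem (mul_mem (inv_mem hw) ((ha _).1 (self_mem_cen _))) hw
      have hs' := hs.conj' (a * w)
      have hs'j : j ≠ (a * w)⁻¹ * s * (a * w) := by
        intro h
        apply hsj
        have : s = (a * w) * ((a * w)⁻¹ * s * (a * w)) * (a * w)⁻¹ := by group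
        rw [this, ← h, hb]
      obtain ⟨-, h6⟩ := cen_eq_of_mem h3 hinv hj ht hjt hbs (hj.mul_ne_one hs'j)
      obtain ⟨e, he, h7⟩ := h4 _ hs' h6
      apply hsA
      rw [DoubleCoset.mem_doubleCoset]
      refine ⟨(a * w) * e⁻¹, mul_mem hbA (inv_mem he), e * (a * w)⁻¹,
        mul_mem he (inv_mem hbA), ?_⟩
      have : s = (a * w) * ((a * w)⁻¹ * s * (a * w)) * (a * w)⁻¹ := by group
      rw [this, h7, conjBy]; group

end Dichotomy

/-! ### Consequences of the conditions: divisibility and the dichotomy in `G`. -/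

namespace Conditions

variable {G : Type u} [Group G] {j t : G}

theorem mem_cen_mul (hG : Conditions j t) {s x : G} (hs : IsInvolution s) (hsj : s ≠ j)
    (hx : x ∈ Cen (j * s)) (hx1 : x ≠ 1) :
    ∃ s', IsInvolution s' ∧ Cen (j * s') = Cen (j * s) ∧ x = j * s' := by
  have h : x ∈ (Cen (j * s) : Set G) := hx
  rw [hG.cen_eq s hs hsj] at h
  rcases h with h | h
  · exact absurd h hx1
  · exact h

theorem inverted (hG : Conditions j t) (hj : IsInvolution j) {s x : G} (hs : IsInvolution s)
    (hsj : s ≠ j) (hx : x ∈ Cen (j * s)) : j * x * j = x⁻¹ := by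
  by_cases hx1 : x = 1
  · rw [hx1, mul_one, hj.mul_self, inv_one]
  · obtain ⟨s', hs', -, rfl⟩ := hG.mem_cen_mul hs hsj hx hx1
    exact mul_mul_self_of_involutions hj hs'

theorem cen_eq_cen (hG : Conditions j t) {s x : G} (hs : IsInvolution s)
    (hsj : s ≠ j) (hx : x ∈ Cen (j * s)) (hx1 : x ≠ 1) : Cen x = Cen (j * s) := by
  obtain ⟨s', -, h, rfl⟩ := hG.mem_cen_mul hs hsj hx hx1
  exact h

theorem zpow_ne_one (hG : Conditions j t) (hj : IsInvolution j) {s x : G} (hs : IsInvolution s)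
    (hsj : s ≠ j) (hx : x ∈ Cen (j * s)) (hx1 : x ≠ 1) {m : ℤ} (hm : m ≠ 0) : x ^ m ≠ 1 := by
  obtain ⟨s', hs', -, rfl⟩ := hG.mem_cen_mul hs hsj hx hx1
  intro h
  refine hG.infinite_order j s' hj hs' ?_ (isOfFinOrder_iff_zpow_eq_one.2 ⟨m, hm, h⟩)
  rintro rfl
  exact hx1 hj.mul_self

/-- By (5') such an `x` is `j s'` with `s' ≈_j t`, and by (4') `s'` is a conjugate of `t` under `Cen
j`. -/
theorem exists_conj (hG : Conditions j t) (ht : IsInvolution t) (hjt : j ≠ t) {x : G}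
    (hx : x ∈ Cen (j * t)) (hx1 : x ≠ 1) : ∃ a ∈ Cen j, x = a⁻¹ * (j * t) * a := by
  obtain ⟨s', hs', h, rfl⟩ := hG.mem_cen_mul ht hjt.symm hx hx1
  obtain ⟨a, ha, rfl⟩ := hG.equiv_conj s' hs' h
  refine ⟨a, ha, ?_⟩
  have : a⁻¹ * j = j * a⁻¹ := mem_cen.1 (inv_mem ha)
  rw [conjBy, ← mul_assoc a⁻¹, this]
  group

/-- The centralizer of `j t` is divisible. -/
theorem exists_root (hG : Conditions j t) (hj : IsInvolution j) (ht : IsInvolution t)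
    (hjt : j ≠ t) {x : G} (hx : x ∈ Cen (j * t)) {m : ℤ} (hm : m ≠ 0) :
    ∃ w ∈ Cen (j * t), w ^ m = x := by
  by_cases hx1 : x = 1
  · exact ⟨1, one_mem _, by rw [hx1, one_zpow]⟩
  -- The power `(j t) ^ m` is conjugate to `j t`, so `j t` is itself an `m`-th power; conjugation
  -- transfers this to `x`.
  have hroot : ∃ w, w ^ m = j * t := by
    obtain ⟨a, -, h⟩ := hG.exists_conj ht hjt (zpow_mem (self_mem_cen (j * t)) m)
      (hG.zpow_ne_one hj ht hjt.symm (self_mem_cen _) (hj.mul_ne_one hjt) hm)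
    refine ⟨a * (j * t) * a⁻¹, ?_⟩
    rw [conj_zpow, h]; group
  obtain ⟨w, hw⟩ := hroot
  obtain ⟨a, -, h⟩ := hG.exists_conj ht hjt hx hx1
  have hwx : (a⁻¹ * w * a) ^ m = x := by
    have := conj_zpow (i := m) (a := a⁻¹) (b := w)
    rw [inv_inv] at this
    rw [this, hw, h]
  refine ⟨a⁻¹ * w * a, ?_, hwx⟩
  rw [← hG.cen_eq_cen ht hjt.symm hx hx1, mem_cen, ← hwx]
  exact (Commute.refl (a⁻¹ * w * a)).zpow_right m

theorem notMem_cen (hG : Conditions j t) (hj : IsInvolution j) (ht : IsInvolution t)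
    (hjt : j ≠ t) : t ∉ Cen j := fun h =>
  hjt (eq_of_commute hG.infinite_order hj ht (mem_cen.1 h).symm)

/-- The involutions in `A t A` are the conjugates of `t` under `A`. -/
theorem eq_conj_of_mem_doubleCoset (hG : Conditions j t) (hj : IsInvolution j)
    (ht : IsInvolution t) (hjt : j ≠ t) {s : G} (hs : IsInvolution s)
    (h : s ∈ DoubleCoset.doubleCoset t (Cen j : Set G) (Cen j)) :
    ∃ b ∈ Cen j, s = b⁻¹ * t * b := by
  rw [DoubleCoset.mem_doubleCoset] at h
  obtain ⟨a, ha, b, hb, rfl⟩ := h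
  refine ⟨b, hb, ?_⟩
  have h1 := (hs.conj b).mul_self
  have h2 : b * (a * t * b) * b⁻¹ = (b * a) * t := by group
  have h3 : b * a ∈ Cen j := mul_mem hb ha
  rw [h2] at h1
  -- `b s b⁻¹ = (b a) t` is an involution, so `t` inverts `b a`, and malnormality at `t` forces `b a
  -- = 1`.
  have h4 : t * (b * a) * t = (b * a)⁻¹ := by
    refine eq_inv_of_mul_eq_one_right ?_
    rw [← h1]; group
  have h5 := hG.malnormal t (hG.notMem_cen hj ht hjt) _ h3 (by
    rw [conjBy, ht.inv_eq, h4]; exact inv_mem h3)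
  rw [← inv_eq_of_mul_eq_one_right h5]

theorem dichotomy_left (hG : Conditions j t) (hj : IsInvolution j) (ht : IsInvolution t)
    (hjt : j ≠ t) {s : G} (hs : IsInvolution s) (hsj : s ≠ j) :
    CenDichotomy (Cen (j * t)) j s := by
  by_cases h : s ∈ DoubleCoset.doubleCoset t (Cen j : Set G) (Cen j)
  · obtain ⟨b, hb, rfl⟩ := hG.eq_conj_of_mem_doubleCoset hj ht hjt hs h
    refine Or.inr ⟨b⁻¹, fun x => ?_⟩
    have h1 : j * (b⁻¹ * t * b) = b⁻¹ * (j * t) * b⁻¹⁻¹ := by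
      have : j * b⁻¹ = b⁻¹ * j := (mem_cen.1 (inv_mem hb)).symm
      rw [← mul_assoc, ← mul_assoc, this]; group
    rw [h1, mem_cen_conj]
  · obtain ⟨s', hs', -, h2⟩ := hG.cen_cyclic s hs h hsj
    exact Or.inl ⟨j * s', h2, mul_mul_self_of_involutions hj hs'⟩

theorem dichotomy (hG : Conditions j t) (hj : IsInvolution j) (ht : IsInvolution t)
    (hjt : j ≠ t) {i k : G} (hi : IsInvolution i) (hk : IsInvolution k) (hik : i ≠ k) :
    CenDichotomy (Cen (j * t)) i k := by
  obtain ⟨g, rfl⟩ := hG.conj j i hj hi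
  have h := (hG.dichotomy_left hj ht hjt (hk.conj g) (s := g * k * g⁻¹) (fun h => hik (by
    rw [conjBy, ← h]; group))).conj g⁻¹
  have h1 : g⁻¹ * (g * k * g⁻¹) * g⁻¹⁻¹ = k := by group
  rw [h1, inv_inv] at h
  exact h

end Conditions

end SharplyTwoTransitive

/-! ### The Bass-Serre tree of an HNN extension. -/

namespace HNNExtension

open TreeAction NormalWord

variable {G : Type u} [Group G] {A B : Subgroup G} {φ : A ≃* B}

/-- The vertices of the Bass-Serre tree. -/
abbrev Vertex (φ : A ≃* B) : Type u :=
  HNNExtension G A B φ ⧸ (of : G →* HNNExtension G A B φ).range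

/-- The vertex given by the coset of `w`. -/
abbrev vertex (w : HNNExtension G A B φ) : Vertex φ := QuotientGroup.mk w

theorem smul_vertex (g w : HNNExtension G A B φ) : g • vertex w = vertex (g * w) := rfl

theorem exists_vertex (x : Vertex φ) : ∃ w, x = vertex w :=
  ⟨x.out, (QuotientGroup.out_eq' x).symm⟩

theorem vertex_eq_iff {w w' : HNNExtension G A B φ} :
    vertex w = vertex w' ↔ ∃ g : G, w' = w * of g := by
  rw [QuotientGroup.eq, MonoidHom.mem_range]
  exact exists_congr fun g => by rw [eq_inv_mul_iff_mul_eq, eq_comm]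

theorem vertex_mul_of (w : HNNExtension G A B φ) (g : G) : vertex (w * of g) = vertex w :=
  (vertex_eq_iff.2 ⟨g, rfl⟩).symm

theorem smul_vertex_eq_iff {g w : HNNExtension G A B φ} :
    g • vertex w = vertex w ↔ ∃ h : G, g = w * of h * w⁻¹ := by
  rw [smul_vertex, eq_comm, vertex_eq_iff]
  exact exists_congr fun h => by rw [eq_mul_inv_iff_mul_eq]

/-- The exponent sum of the stable letter. -/
def expSum (φ : A ≃* B) : HNNExtension G A B φ →* Multiplicative ℤ :=
  lift 1 (Multiplicative.ofAdd 1) (fun _ => by simp)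

/-- The exponent sum is well-defined on vertices. -/
def level (x : Vertex φ) : ℤ :=
  Quotient.liftOn' x (fun w => (expSum φ w).toAdd) (fun a b h => by
    rw [QuotientGroup.leftRel_apply] at h
    obtain ⟨g, hg⟩ := h
    have : b = a * of g := by rw [hg]; group
    simp [this, expSum])

theorem level_vertex (w : HNNExtension G A B φ) : level (vertex w) = (expSum φ w).toAdd := rfl

theorem level_smul (g : HNNExtension G A B φ) (x : Vertex φ) :
    level (g • x) = (expSum φ g).toAdd + level x := by
  obtain ⟨w, rfl⟩ := exists_vertex x
  rw [smul_vertex, level_vertex, level_vertex, map_mul, toAdd_mul]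

/-- There is an oriented edge from `w G` to `w t G`. -/
def Out (x y : Vertex φ) : Prop := ∃ w, x = vertex w ∧ y = vertex (w * t)

theorem Out.smul {x y : Vertex φ} (h : Out x y) (g : HNNExtension G A B φ) :
    Out (g • x) (g • y) := by
  obtain ⟨w, rfl, rfl⟩ := h
  exact ⟨g * w, rfl, by rw [smul_vertex, mul_assoc]⟩

theorem Out.level_eq {x y : Vertex φ} (h : Out x y) : level y = level x + 1 := by
  obtain ⟨w, rfl, rfl⟩ := h
  simp [level_vertex, expSum]

theorem Out.asymm {x y : Vertex φ} (h : Out x y) : ¬ Out y x := fun h' => by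
  have h1 := h.level_eq
  have h2 := h'.level_eq
  omega

/-- The Bass-Serre tree of an HNN extension. -/
def tree (φ : A ≃* B) : SimpleGraph (Vertex φ) where
  Adj x y := Out x y ∨ Out y x
  symm := ⟨fun _ _ h => h.symm⟩
  loopless := ⟨fun _ h => h.elim (fun h => h.asymm h) (fun h => h.asymm h)⟩

theorem tree_adj_smul (g : HNNExtension G A B φ) (x y : Vertex φ) (h : (tree φ).Adj x y) :
    (tree φ).Adj (g • x) (g • y) :=
  h.imp (fun h => h.smul g) (fun h => h.smul g)

/-- An element shifts all levels by its exponent sum, and adjacent vertices have different levels.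
-/
theorem no_inversion (g : HNNExtension G A B φ) (x y : Vertex φ) (h : (tree φ).Adj x y)
    (hx : g • x = y) : g • y ≠ x := by
  intro hy
  have h1 := level_smul g x
  have h2 := level_smul g y
  rw [hx] at h1
  rw [hy] at h2
  rcases h with h | h <;> have h3 := h.level_eq <;> omega

theorem exists_of_adj {w : HNNExtension G A B φ} {y : Vertex φ}
    (h : (tree φ).Adj (vertex w) y) : ∃ (g : G) (ε : ℤˣ), y = vertex (w * of g * t ^ (ε : ℤ)) := by
  rcases h with ⟨w', h1, rfl⟩ | ⟨w', rfl, h1⟩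
  · obtain ⟨g, rfl⟩ := vertex_eq_iff.1 h1
    exact ⟨g, 1, by simp⟩
  · obtain ⟨g, hg⟩ := vertex_eq_iff.1 h1
    refine ⟨g, -1, ?_⟩
    rw [← hg]; simp

theorem vertex_conj_eq {w : HNNExtension G A B φ} {ε : ℤˣ} {g : G} (hg : g ∈ toSubgroup A B ε) :
    vertex (w * t ^ (ε : ℤ) * of g * t ^ ((-ε : ℤˣ) : ℤ)) = vertex w := by
  rcases Int.units_eq_one_or ε with rfl | rfl
  · have h := equiv_eq_conj (φ := φ) ⟨g, hg⟩
    rw [← vertex_mul_of w (φ ⟨g, hg⟩), h]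
    simp [mul_assoc]
  · have h := equiv_symm_eq_conj (φ := φ) ⟨g, hg⟩
    rw [← vertex_mul_of w (φ.symm ⟨g, hg⟩), h]
    simp [mul_assoc]

/-- A pinch in the word would be a backtrack in the path. The last clause remembers the first edge,
which the induction needs to exclude a pinch when a letter is prepended. -/
theorem exists_reducedWord (n : ℕ) : ∀ (p : ℤ → Vertex φ) (a : ℤ) (w : HNNExtension G A B φ),
    IsReduced (tree φ) p a (a + n) → p a = vertex w →
    ∃ v : ReducedWord G A B, p (a + n) = vertex (w * v.prod φ) ∧ v.toList.length = n ∧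
      ∀ x ∈ v.toList.head?, p (a + 1) = vertex (w * of v.head * t ^ (x.1 : ℤ)) := by
  induction n with
  | zero =>
    intro p a w _ h0
    exact ⟨ReducedWord.empty G A B, by simp [ReducedWord.prod, h0], rfl, by simp⟩
  | succ n ih =>
    intro p a w hp h0
    push_cast at hp ⊢
    have hadj := hp.adj a le_rfl (by omega)
    rw [h0] at hadj
    obtain ⟨g, ε, h1⟩ := exists_of_adj hadj
    obtain ⟨v, hv1, hv2, hv3⟩ := ih p (a + 1) _ (hp.mono (by omega) (by omega) (by omega)) h1
    refine ⟨⟨g, (ε, v.head) :: v.toList, ?_⟩, ?_, by simp [hv2], by simp [h1]⟩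
    · refine List.isChain_cons.2 ⟨?_, v.chain⟩
      rintro ⟨ε', g'⟩ hx hmem
      by_contra hne
      have hε : ε' = -ε := by
        rcases Int.units_eq_one_or ε with rfl | rfl <;>
        rcases Int.units_eq_one_or ε' with rfl | rfl <;> simp_all
      subst hε
      have h2 := hv3 _ hx
      have hn : n ≠ 0 := by
        rintro rfl
        rw [List.length_eq_zero_iff] at hv2
        simp [hv2] at hx
      refine hp.ne (a + 1) (by omega) (by omega) ?_
      rw [h2, vertex_conj_eq hmem, vertex_mul_of, add_sub_cancel_right, h0]
    · have he : p (a + ((n : ℤ) + 1)) = p (a + 1 + n) := congrArg p (by ring)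
      refine he.trans (hv1.trans ?_)
      simp only [ReducedWord.prod, List.map_cons, List.prod_cons, mul_assoc]

theorem tree_isReducedTree (φ : A ≃* B) : IsReducedTree (tree φ) where
  ne_of_lt p a b hp hab he := by
    obtain ⟨n, rfl⟩ : ∃ n : ℕ, b = a + n := ⟨(b - a).toNat, by omega⟩
    obtain ⟨w, hw⟩ := exists_vertex (p a)
    obtain ⟨v, hv, hlen, -⟩ := exists_reducedWord n p a w hp hw
    rw [← he, hw] at hv
    obtain ⟨g, hg⟩ := vertex_eq_iff.1 hv
    -- Britton's lemma: a reduced word representing an element of the base group contains no stable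
    -- letter.
    have h1 := ReducedWord.toList_eq_nil_of_mem_of_range φ v ⟨g, (mul_left_cancel hg).symm⟩
    rw [h1] at hlen
    simp at hlen
    omega
  exists_path := by
    let R : Vertex φ → Vertex φ → Prop := fun x y =>
      ∃ (p : ℤ → Vertex φ) (n : ℕ), IsReduced (tree φ) p 0 n ∧ p 0 = x ∧ p n = y
    have hrefl : ∀ x, R x x := fun x =>
      ⟨fun _ => x, 0, ⟨by simp, fun i _ _ => by simp at *; omega, fun i _ _ => by simp at *; omega⟩,
        rfl, rfl⟩
    have hstep : ∀ x y z, R x y → (tree φ).Adj y z → R x z := by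
      rintro x y z ⟨p, n, hp, h0, h1⟩ hyz
      by_cases hback : n ≠ 0 ∧ p (n - 1) = z
      · refine ⟨p, n - 1, hp.mono le_rfl (by omega) (by omega), h0, ?_⟩
        rw [← hback.2]; congr 1; omega
      · have hq : IsReduced (tree φ) (fun i => if i = n then y else z) n ((n + 1 : ℕ) : ℤ) := by
          refine ⟨by simp, fun i h2 h3 => ?_, fun i h2 h3 => by omega⟩
          rw [if_pos (by omega), if_neg (by omega)]
          exact hyz
        have := hp.concat hq (by simp [h1]) (fun h2 _ h3 => hback ⟨by omega, by simpa using h3⟩)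
        refine ⟨_, n + 1, this, ?_, ?_⟩
        · simp [h0]
        · rw [if_neg (by push_cast; omega), if_neg (by push_cast; omega)]
    have htrans : ∀ x y z, R x y → R y z → R x z := by
      rintro x y z hxy ⟨p, n, hp, h0, h1⟩
      have : ∀ k : ℕ, k ≤ n → R x (p k) := by
        intro k
        induction k with
        | zero => intro _; simpa [h0] using hxy
        | succ k ih =>
          intro hk
          have := hstep _ _ _ (ih (by omega)) (hp.adj k (by omega) (by omega))
          exact_mod_cast this
      rw [← h1]
      exact this n le_rfl
    have hsmul : ∀ (g : HNNExtension G A B φ) x y, R x y → R (g • x) (g • y) := by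
      rintro g x y ⟨p, n, hp, rfl, rfl⟩
      exact ⟨fun i => g • p i, n, hp.smul tree_adj_smul g, rfl, rfl⟩
    have hsymm : ∀ x y, R x y → R y x := by
      rintro x y ⟨p, n, hp, rfl, rfl⟩
      have h := hp.reverse n
      rw [sub_self, sub_zero] at h
      exact ⟨_, n, h, by simp, by simp⟩
    have hbase : ∀ g : HNNExtension G A B φ, R (vertex 1) (vertex g) := by
      intro g
      induction g using HNNExtension.induction_on with
      | of g =>
        have := vertex_mul_of (1 : HNNExtension G A B φ) g
        rw [one_mul] at this
        rw [this]
        exact hrefl _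
      | t => exact hstep _ _ _ (hrefl _) (Or.inl ⟨1, rfl, by rw [one_mul]⟩)
      | mul x y hx hy =>
        have := hsmul x _ _ hy
        rw [smul_vertex, smul_vertex, mul_one] at this
        exact htrans _ _ _ hx this
      | inv x hx =>
        have := hsmul x⁻¹ _ _ hx
        rw [smul_vertex, smul_vertex, mul_one, inv_mul_cancel] at this
        exact hsymm _ _ this
    intro x y
    obtain ⟨a, rfl⟩ := exists_vertex x
    obtain ⟨b, rfl⟩ := exists_vertex y
    exact htrans _ _ _ (hsymm _ _ (hbase a)) (hbase b)

/-- The stabilizer of an edge is a conjugate of `B`. -/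
theorem exists_of_fixes_edge {g w : HNNExtension G A B φ} (h1 : g • vertex w = vertex w)
    (h2 : g • vertex (w * t) = vertex (w * t)) : ∃ b : B, g = w * of (b : G) * w⁻¹ := by
  obtain ⟨h, rfl⟩ := smul_vertex_eq_iff.1 h1
  obtain ⟨k, hk⟩ := smul_vertex_eq_iff.1 h2
  by_cases hB : h ∈ B
  · exact ⟨⟨h, hB⟩, rfl⟩
  · exfalso
    -- For `h ∉ B` the word `t⁻¹ h t` is reduced, yet it represents an element of the base group,
    -- contrary to Britton's lemma.
    let v : ReducedWord G A B := ⟨1, [(-1, h), (1, 1)], by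
      simp only [List.isChain_cons_cons, toSubgroup_neg_one, List.isChain_singleton, and_true]
      exact fun h' => absurd h' hB⟩
    have hv : v.prod φ = of k := by
      have h3 : (of h : HNNExtension G A B φ) = t * of k * t⁻¹ := by
        have : (of h : HNNExtension G A B φ) = w⁻¹ * (w * of h * w⁻¹) * w := by group
        rw [this, hk]; group
      simp [v, ReducedWord.prod, h3, mul_assoc]
    have := ReducedWord.toList_eq_nil_of_mem_of_range φ v ⟨k, hv.symm⟩
    simp [v] at this

theorem exists_of_fixes_out {g : HNNExtension G A B φ} {x y : Vertex φ} (hxy : Out x y)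
    (hx : g • x = x) (hy : g • y = y) :
    ∃ (w : HNNExtension G A B φ) (b : B), x = vertex w ∧ y = vertex (w * t) ∧
      g = w * of (b : G) * w⁻¹ := by
  obtain ⟨w, rfl, rfl⟩ := hxy
  obtain ⟨b, hb⟩ := exists_of_fixes_edge hx hy
  exact ⟨w, b, rfl, rfl, hb⟩

end HNNExtension

/-! ### Acylindricity and centralizers in HNN extensions. -/

namespace HNNExtension

open TreeAction SharplyTwoTransitive

variable {G : Type u} [Group G] {A B : Subgroup G} {φ : A ≃* B}

/-- Elements of the edge group that are not of order at most two lie in no other conjugate of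
`B` and in no conjugate of `A` inside the base group. -/
structure IsAcylindrical (A B : Subgroup G) : Prop where
  mem_of_conj_mem : ∀ a : G, ∀ g ∈ B, g * g ≠ 1 → a⁻¹ * g * a ∈ B → a ∈ B
  conj_notMem : ∀ a : G, ∀ g ∈ B, g * g ≠ 1 → a⁻¹ * g * a ∉ A

theorem mul_self_ne_one_of_conj {w : HNNExtension G A B φ} {b : G}
    (h : w * of b * w⁻¹ * (w * of b * w⁻¹) ≠ 1) : b * b ≠ 1 := by
  intro hb
  apply h
  have : w * of b * w⁻¹ * (w * of b * w⁻¹) = w * of (b * b) * w⁻¹ := by rw [map_mul]; group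
  rw [this, hb, map_one]; group

/-- The tail of a fixed edge is a leaf of the fixed subtree. After conjugation the tail is the base
vertex and `g ∈ B`: a second fixed outgoing edge is excluded by `mem_of_conj_mem`, a fixed incoming
one by `conj_notMem`. -/
theorem eq_of_fixes (hAB : IsAcylindrical A B) {g : HNNExtension G A B φ} (hg : g * g ≠ 1)
    {x y z : Vertex φ} (hx : g • x = x) (hy : g • y = y) (hz : g • z = z)
    (hyx : Out y x) (hyz : (tree φ).Adj y z) : z = x := by
  obtain ⟨w, b, rfl, rfl, rfl⟩ := exists_of_fixes_out hyx hy hx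
  have hb := mul_self_ne_one_of_conj hg
  rcases hyz with hyz | hyz
  · obtain ⟨w', b', h1, rfl, h2⟩ := exists_of_fixes_out hyz hy hz
    obtain ⟨a, rfl⟩ := vertex_eq_iff.1 h1
    have h3 : a⁻¹ * b * a = b' := by
      apply of_injective (φ := φ)
      have : (of (b : G) : HNNExtension G A B φ) = w⁻¹ * (w * of (b : G) * w⁻¹) * w := by group
      rw [map_mul, map_mul, map_inv, this, h2]; group
    have h4 := hAB.mem_of_conj_mem a b b.2 hb (h3 ▸ b'.2)
    have h5 := of_mul_t (φ := φ) ⟨a, h4⟩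
    rw [mul_assoc, h5, ← mul_assoc, vertex_mul_of]
  · exfalso
    obtain ⟨w', b', rfl, h1, h2⟩ := exists_of_fixes_out hyz hz hy
    obtain ⟨a, ha⟩ := vertex_eq_iff.1 h1
    obtain rfl : w' = w * of a * t⁻¹ := by rw [← ha]; group
    have h3 : a⁻¹ * b * a = φ.symm b' := by
      apply of_injective (φ := φ)
      have : (of (b : G) : HNNExtension G A B φ) = w⁻¹ * (w * of (b : G) * w⁻¹) * w := by group
      rw [map_mul, map_mul, map_inv, this, h2, equiv_symm_eq_conj]; group
    exact hAB.conj_notMem a b b.2 hb (h3 ▸ (φ.symm b').2)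

/-- The pointwise stabilizers of paths of length three have exponent two. -/
theorem mul_self_of_fixes_path (hAB : IsAcylindrical A B) {g : HNNExtension G A B φ}
    {p : ℤ → Vertex φ} (hp : IsReduced (tree φ) p 0 3) (hg : ∀ i, g • p i = p i) :
    g * g = 1 := by
  by_contra hne
  have h01 := hp.adj 0 (by omega) (by omega)
  have h12 := hp.adj 1 (by omega) (by omega)
  have h23 := hp.adj 2 (by omega) (by omega)
  have hne1 := hp.ne 1 (by omega) (by omega)
  have hne2 := hp.ne 2 (by omega) (by omega)
  norm_num at h01 h12 h23 hne1 hne2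
  -- The tail of the middle edge has two distinct fixed neighbours, on whichever side it lies.
  rcases h12 with h | h
  · exact hne1 (eq_of_fixes hAB hne (hg _) (hg _) (hg _) h h01.symm)
  · exact hne2 (eq_of_fixes hAB hne (hg _) (hg _) (hg _) h h23).symm

theorem smul_vertex_of_commute {g x : HNNExtension G A B φ} (hx : x * g = g * x)
    (hg : g • vertex (1 : HNNExtension G A B φ) = vertex 1) : g • vertex x = vertex x := by
  have h : vertex x = x • vertex (1 : HNNExtension G A B φ) := by rw [smul_vertex, mul_one]
  rw [h, ← mul_smul, ← hx, mul_smul, hg]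

theorem of_smul_vertex_one (g : G) :
    (of g : HNNExtension G A B φ) • vertex (1 : HNNExtension G A B φ) = vertex 1 :=
  smul_vertex_eq_iff.2 ⟨g, by group⟩

theorem mem_range_of_vertex_eq {x : HNNExtension G A B φ} (h : vertex x = vertex 1) :
    x ∈ (of : G →* HNNExtension G A B φ).range := by
  obtain ⟨g, rfl⟩ := vertex_eq_iff.1 h.symm
  exact ⟨g, by simp⟩

/-- The element fixes the edge from `t⁻¹ G` to `G`. Tails of fixed edges being leaves, its fixed
subtree is a star centred at `G` with all edges pointing to `G`; the vertex `x G` lies in this star.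
-/
theorem vertex_of_commute (hAB : IsAcylindrical A B) (a : A) (ha : (a : G) * a ≠ 1)
    {x : HNNExtension G A B φ} (hx : x * of (a : G) = of (a : G) * x) :
    vertex x = vertex 1 ∨ Out (vertex x) (vertex 1) := by
  have hT := tree_isReducedTree φ
  set c : HNNExtension G A B φ := of (a : G) with hc
  have hcc : c * c ≠ 1 := by
    rw [hc, ← map_mul]
    exact fun h => ha (of_injective (φ := φ) (by rw [h, map_one]))
  have h1 : c • vertex (1 : HNNExtension G A B φ) = vertex 1 := of_smul_vertex_one _
  have h2 : c • vertex (t⁻¹ : HNNExtension G A B φ) = vertex t⁻¹ := by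
    rw [smul_vertex, hc, of_mul_inv_t, vertex_mul_of]
  have h3 : Out (vertex (t⁻¹ : HNNExtension G A B φ)) (vertex 1) := ⟨t⁻¹, rfl, by simp⟩
  have hnb : ∀ y, c • y = y → (tree φ).Adj (vertex 1) y → Out y (vertex 1) := by
    intro y hy hadj
    rcases hadj with h | h
    · have h4 := eq_of_fixes hAB hcc hy h1 h2 h (Or.inr h3)
      rwa [h4] at h3
    · exact h
  obtain ⟨p, n, hp, hp0, hpn⟩ := hT.exists_path (vertex 1) (vertex x)
  have hfix := fixes_path hT tree_adj_smul hp (g := c) (by rw [hp0, h1])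
    (by rw [hpn, smul_vertex_of_commute hx h1])
  rcases Nat.eq_zero_or_pos n with rfl | hn
  · left; rw [← hp0, ← hpn]; simp
  right
  have h5 : Out (p 1) (vertex 1) := by
    refine hnb _ (hfix 1 (by omega) (by omega)) ?_
    have := hp.adj 0 le_rfl (by omega)
    rwa [hp0, zero_add] at this
  rcases Nat.lt_or_ge 1 n with hn1 | hn1
  · exfalso
    have h6 := hp.adj 1 (by omega) (by omega)
    have h7 := hp.ne 1 (by omega) (by omega)
    rw [sub_self, hp0] at h7
    exact h7 (eq_of_fixes hAB hcc h1 (hfix 1 (by omega) (by omega))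
      (hfix (1 + 1) (by omega) (by omega)) h5 h6).symm
  · obtain rfl : n = 1 := by omega
    rw [← hpn]; exact_mod_cast h5

/-- The centralizer of an element of `A` of order greater than two is in the base group. -/
theorem mem_range_of_commute (hAB : IsAcylindrical A B) (a : A) (ha : (a : G) * a ≠ 1)
    {x : HNNExtension G A B φ} (hx : x * of (a : G) = of (a : G) * x) :
    x ∈ (of : G →* HNNExtension G A B φ).range := by
  rcases vertex_of_commute hAB a ha hx with h | h
  · exact mem_range_of_vertex_eq h
  have hx' : x⁻¹ * of (a : G) = of (a : G) * x⁻¹ := (Commute.inv_left (a := x) hx)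
  rcases vertex_of_commute hAB a ha hx' with h' | h'
  · exact inv_mem_iff.1 (mem_range_of_vertex_eq h')
  · exfalso
    -- Translating the edge from `x⁻¹ G` to `G` by `x` reverses the edge from `x G` to `G`,
    -- contradicting the orientation.
    have := h'.smul x
    rw [smul_vertex, smul_vertex, mul_inv_cancel, mul_one] at this
    exact h.asymm this

/-- An element of the base group whose centralizer is not contained in the base group is conjugate
into `A`. -/
theorem exists_conj_of_commute {g : G} {x : HNNExtension G A B φ} (hx : x * of g = of g * x)
    (hxG : x ∉ (of : G →* HNNExtension G A B φ).range) :
    ∃ (w : HNNExtension G A B φ) (a : A), of g = w * of (a : G) * w⁻¹ := by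
  have hT := tree_isReducedTree φ
  have h1 : (of g : HNNExtension G A B φ) • vertex (1 : HNNExtension G A B φ) = vertex 1 :=
    of_smul_vertex_one g
  obtain ⟨p, n, hp, hp0, hpn⟩ := hT.exists_path (vertex 1) (vertex x)
  -- The element fixes both `G` and the different vertex `x G`, hence an edge; edge stabilizers are
  -- conjugates of `B`, and so of `A`.
  have hfix := fixes_path hT tree_adj_smul hp (g := of g) (by rw [hp0, h1])
    (by rw [hpn, smul_vertex_of_commute hx h1])
  have hn : 0 < n := by
    refine Nat.pos_of_ne_zero ?_
    rintro rfl
    exact hxG (mem_range_of_vertex_eq (by rw [← hp0, ← hpn]; simp))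
  have key : ∀ y z : Vertex φ, (of g : HNNExtension G A B φ) • y = y →
      (of g : HNNExtension G A B φ) • z = z → Out y z →
      ∃ (w : HNNExtension G A B φ) (a : A), of g = w * of (a : G) * w⁻¹ := by
    intro y z hy hz hyz
    obtain ⟨w, b, -, -, h⟩ := exists_of_fixes_out hyz hy hz
    exact ⟨w * t, φ.symm b, by rw [h, equiv_symm_eq_conj]; group⟩
  have f0 := hfix 0 le_rfl (by omega)
  have f1 := hfix (0 + 1) (by omega) (by omega)
  rcases hp.adj 0 le_rfl (by omega) with h | h
  · exact key _ _ f0 f1 h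
  · exact key _ _ f1 f0 h

/-- If the product of two involutions fixes a vertex, so do both of them. -/
theorem exists_common_conj {i k : HNNExtension G A B φ} (hi : IsInvolution i)
    (hk : IsInvolution k) {x : Vertex φ} (hx : (i * k) • x = x) :
    ∃ (w : HNNExtension G A B φ) (i' k' : G), IsInvolution i' ∧ IsInvolution k' ∧
      i = w * of i' * w⁻¹ ∧ k = w * of k' * w⁻¹ := by
  obtain ⟨y, hy, hiy⟩ := exists_common_fixed (tree_isReducedTree φ) tree_adj_smul no_inversion
    (j := i) (h := i * k) hi.mul_self
    (by rw [mul_inv_rev, hi.inv_eq, hk.inv_eq, mul_assoc]) hx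
  have hky : k • y = y := by rw [← hi.mul_mul_cancel k, mul_smul, hy, hiy]
  obtain ⟨w, rfl⟩ := exists_vertex y
  obtain ⟨i', rfl⟩ := smul_vertex_eq_iff.1 hiy
  obtain ⟨k', rfl⟩ := smul_vertex_eq_iff.1 hky
  refine ⟨w, i', k', ?_, ?_, rfl, rfl⟩
  · have h := hi.conj' w
    rw [show w⁻¹ * (w * of i' * w⁻¹) * w = of i' by group] at h
    exact (isInvolution_map_iff _ (of_injective φ)).1 h
  · have h := hk.conj' w
    rw [show w⁻¹ * (w * of k' * w⁻¹) * w = of k' by group] at h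
    exact (isInvolution_map_iff _ (of_injective φ)).1 h

/-- Every involution of an HNN extension is conjugate into the base group. -/
theorem exists_conj_of_isInvolution {i : HNNExtension G A B φ} (hi : IsInvolution i) :
    ∃ (w : HNNExtension G A B φ) (i' : G), IsInvolution i' ∧ i = w * of i' * w⁻¹ := by
  obtain ⟨w, i', -, h1, -, h2, -⟩ := exists_common_conj hi hi (x := vertex 1)
    (by rw [hi.mul_self, one_smul])
  exact ⟨w, i', h1, h2⟩

/-- If products of distinct involutions of the base group have infinite order, then so do those
of the HNN extension. -/
theorem not_isOfFinOrder_mul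
    (h3 : ∀ r s : G, IsInvolution r → IsInvolution s → r ≠ s → ¬ IsOfFinOrder (r * s))
    (r s : HNNExtension G A B φ) (hr : IsInvolution r) (hs : IsInvolution s) (hrs : r ≠ s) :
    ¬ IsOfFinOrder (r * s) := by
  by_cases hfix : ∃ x : Vertex φ, (r * s) • x = x
  · obtain ⟨x, hx⟩ := hfix
    obtain ⟨w, r', s', hr', hs', rfl, rfl⟩ := exists_common_conj hr hs hx
    let F : G →* HNNExtension G A B φ := (MulAut.conj w).toMonoidHom.comp of
    have hF : Function.Injective F := (MulAut.conj w).injective.comp (of_injective φ)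
    have h1 : w * of r' * w⁻¹ * (w * of s' * w⁻¹) = F (r' * s') := by
      rw [map_mul]; rfl
    rw [h1, hF.isOfFinOrder_iff]
    exact h3 r' s' hr' hs' (fun h => hrs (by rw [h]))
  · push Not at hfix
    have : Nonempty (Vertex φ) := ⟨vertex 1⟩
    obtain ⟨n, L, hn, hL⟩ := exists_isAxis (tree_isReducedTree φ) tree_adj_smul no_inversion hfix
    exact hL.not_isOfFinOrder (tree_isReducedTree φ) hn

/-- If the product of two involutions acts without fixed vertices, its centralizer is cyclic. -/
theorem cen_cyclic_of_no_fixed (hAB : IsAcylindrical A B)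
    (h3 : ∀ r s : HNNExtension G A B φ, IsInvolution r → IsInvolution s → r ≠ s →
      ¬ IsOfFinOrder (r * s))
    {i k : HNNExtension G A B φ} (hi : IsInvolution i) (hk : IsInvolution k)
    (hfix : ∀ x : Vertex φ, (i * k) • x ≠ x) :
    ∃ z, Cen (i * k) = Subgroup.zpowers z ∧ i * z * i = z⁻¹ := by
  have hT := tree_isReducedTree φ
  have hik : i ≠ k := by
    rintro rfl
    exact hfix (vertex 1) (by rw [hi.mul_self, one_smul])
  have : Nonempty (Vertex φ) := ⟨vertex 1⟩
  obtain ⟨n, L, hn, hL⟩ := exists_isAxis hT tree_adj_smul no_inversion hfix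
  have hiki : i * k * i = i * (i * k)⁻¹ := by rw [mul_inv_rev, hi.inv_eq, hk.inv_eq, mul_assoc]
  -- Since `i` inverts `i k`, it preserves the axis and acts on it as a reflection.
  obtain ⟨d, hd⟩ := hL.eq_shift hT tree_adj_smul hn (hL.smul_of_invert tree_adj_smul hiki)
  have hd' : ∀ m, i • L m = L (d - m) := fun m => by
    have := hd (-m)
    rw [neg_neg] at this
    rw [this]; congr 1; ring
  have hshift : ∀ x ∈ Cen (i * k), ∃ c, ∀ m, x • L m = L (m + c) := fun x hx =>
    hL.eq_shift hT tree_adj_smul hn (hL.smul_of_commute tree_adj_smul (mem_cen.1 hx).symm)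
  -- The centralizer acts faithfully on the axis.
  have hpath : IsReduced (tree φ) L 0 3 := hL.isReduced (by norm_num)
  have hsq : ∀ x : HNNExtension G A B φ, (∀ m, x • L m = L m) → x * x = 1 := fun x hx =>
    mul_self_of_fixes_path hAB hpath hx
  have hfaith : ∀ x ∈ Cen (i * k), (∀ m, x • L m = L m) → x = 1 := by
    intro x hx hxL
    by_contra hx1
    have hxi : IsInvolution x := isInvolution_iff.2 ⟨hsq x hxL, hx1⟩
    have hxi' : IsInvolution (i * x * i) := by
      have := hxi.conj i
      rwa [hi.inv_eq] at this
    -- Both `x` and `i x i` fix the axis pointwise, so their product has square `1` and (3) makes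
    -- them equal. Then `x` commutes with `i`, so `x = i`, and `i` would commute with `k`.
    have h1 := hsq (x * (i * x * i)) (fun m => by
      rw [mul_smul, mul_smul, mul_smul, hd', hxL, hd', sub_sub_cancel, hxL])
    have h2 : x = i * x * i := by
      by_contra hne
      exact h3 _ _ hxi hxi' hne (isOfFinOrder_iff_pow_eq_one.2 ⟨2, two_pos, by rw [pow_two, h1]⟩)
    have h4 : x = i := eq_of_commute h3 hxi hi (by
      nth_rw 1 [h2]; rw [hi.mul_mul_cancel_right])
    rw [h4, mem_cen, mul_assoc, mul_right_inj] at hx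
    exact hik (eq_of_commute h3 hi hk hx)
  choose c hc using hshift
  -- Signed translation length along the axis embeds the centralizer in `ℤ`.
  let τ : Cen (i * k) →* Multiplicative ℤ := MonoidHom.mk'
    (fun x => Multiplicative.ofAdd (c x x.2)) (fun x y => by
      have h1 := hc _ (x * y).2 0
      have h2 : ((x * y : Cen (i * k)) : HNNExtension G A B φ) • L 0 = L (0 + c y y.2 + c x x.2) := by
        rw [Subgroup.coe_mul, mul_smul, hc _ y.2, hc _ x.2]
      have h3 := hL.injective hT (h1.symm.trans h2)
      rw [← ofAdd_add]
      exact congrArg Multiplicative.ofAdd (by omega))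
  have hτ : Function.Injective τ := by
    rw [injective_iff_map_eq_one]
    intro x hx
    have h1 : c x x.2 = 0 := hx
    exact Subtype.ext (hfaith x x.2 (fun m => by rw [hc _ x.2, h1, add_zero]))
  have := isCyclic_of_injective τ hτ
  obtain ⟨z, hz⟩ := (Subgroup.isCyclic_iff_exists_zpowers_eq_top (Cen (i * k))).1 inferInstance
  have hzc : z ∈ Cen (i * k) := hz ▸ Subgroup.mem_zpowers z
  -- The element `i z i z` lies in the centralizer and acts trivially on the axis, because the
  -- reflection `i` reverses the translation `z`.
  refine ⟨z, hz.symm, eq_inv_of_mul_eq_one_left (hfaith _ (mul_mem ?_ hzc) fun m => ?_)⟩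
  · rw [mem_cen]
    have h1 : i * (i * k) = (i * k)⁻¹ * i := by
      rw [mul_inv_rev, hi.inv_eq, hk.inv_eq, hi.mul_mul_cancel, hi.mul_mul_cancel_right]
    have h2 : z * (i * k)⁻¹ = (i * k)⁻¹ * z := Commute.inv_right (mem_cen.1 hzc)
    calc i * z * i * (i * k) = i * (z * (i * k)⁻¹) * i := by
          rw [mul_assoc _ i, h1]; group
      _ = (i * (i * k)⁻¹) * z * i := by rw [h2]; group
      _ = i * k * (i * z * i) := by rw [← hiki]; group
  · rw [mul_smul, mul_smul, mul_smul, hc z hzc, hd', hc z hzc, hd']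
    congr 1; ring

end HNNExtension

namespace SharplyTwoTransitive

/-! ### Infinite dihedral subgroups. -/

section Dihedral

variable {G : Type u} [Group G]

/-- The homomorphism from the infinite dihedral group given by an involution `i` inverting `y`. -/
def dihedralHom (i y : G) (hi : i * i = 1) (hy : i * y * i = y⁻¹) : DihedralGroup 0 →* G where
  toFun
    -- `ZMod 0` is `ℤ` by definition; the lambda makes the exponent an integer.
    | .r n => (fun m : ℤ => y ^ m) n
    | .sr n => (fun m : ℤ => i * y ^ m) n
  map_one' := zpow_zero y
  map_mul' := by
    have key : ∀ n : ℤ, y ^ n * i = i * (y ^ n)⁻¹ := fun n => by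
      rw [← inverted_of_mem_zpowers hi hy (Subgroup.zpow_mem_zpowers y n), ← mul_assoc,
        ← mul_assoc, hi, one_mul]
    rintro (a | a) (b | b) <;> change ℤ at a b
    · exact zpow_add y a b
    · change i * y ^ ((b : ℤ) - a) = y ^ (a : ℤ) * (i * y ^ (b : ℤ))
      rw [← mul_assoc, key, mul_assoc, ← zpow_neg, ← zpow_add, neg_add_eq_sub]
    · change i * y ^ ((a : ℤ) + b) = i * y ^ (a : ℤ) * y ^ (b : ℤ)
      rw [zpow_add, mul_assoc]
    · change y ^ ((b : ℤ) - a) = i * y ^ (a : ℤ) * (i * y ^ (b : ℤ))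
      rw [mul_assoc, ← mul_assoc (y ^ (a : ℤ)), key, ← mul_assoc, ← mul_assoc, hi, one_mul,
        ← zpow_neg, ← zpow_add, neg_add_eq_sub]

variable {i y : G} {hi : i * i = 1} {hy : i * y * i = y⁻¹}

theorem dihedralHom_r (n : ℤ) : dihedralHom i y hi hy (.r n) = y ^ n := rfl

theorem dihedralHom_sr (n : ℤ) : dihedralHom i y hi hy (.sr n) = i * y ^ n := rfl

theorem dihedralHom_injective (hne : ∀ m : ℤ, m ≠ 0 → y ^ m ≠ 1) :
    Function.Injective (dihedralHom i y hi hy) := by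
  rw [injective_iff_map_eq_one]
  rintro (n | n) h <;> change ℤ at n
  · rw [dihedralHom_r] at h
    by_contra hn
    refine hne n (fun h0 => hn ?_) h
    rw [h0]; rfl
  · exfalso
    rw [dihedralHom_sr] at h
    -- If a reflection were trivial, `i` would be a power of `y`, so it would both commute with `y`
    -- and invert it, giving `y ^ 2 = 1`.
    have h2 : y ^ n = i :=
      (inv_eq_of_mul_eq_one_right h).symm.trans (inv_eq_of_mul_eq_one_left hi)
    have h3 : y * i = i * y := by rw [← h2, ← zpow_one_add, ← zpow_add_one, add_comm]
    have h4 : y⁻¹ = y := by rw [← hy, ← h3, mul_assoc, hi, mul_one]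
    refine hne 2 two_ne_zero ?_
    rw [zpow_two]
    nth_rw 1 [← h4]
    exact inv_mul_cancel y

theorem zpow_mem_range (n : ℤ) : y ^ n ∈ (dihedralHom i y hi hy).range := ⟨.r n, rfl⟩

theorem mul_zpow_mem_range (n : ℤ) : i * y ^ n ∈ (dihedralHom i y hi hy).range := ⟨.sr n, rfl⟩

theorem eq_zpow_of_mem_range {g : G} (hg : g ∈ (dihedralHom i y hi hy).range) (hgg : g * g ≠ 1) :
    ∃ n : ℤ, n ≠ 0 ∧ g = y ^ n := by
  obtain ⟨n | n, rfl⟩ := hg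
  · refine ⟨n, ?_, rfl⟩
    rintro rfl
    exact hgg (by rw [← map_mul]; exact map_one _)
  · exfalso
    apply hgg
    rw [← map_mul, DihedralGroup.sr_mul_sr, sub_self]
    exact map_one _

end Dihedral

/-! ### Transfer of the conditions to the HNN extension. -/

section Extension

open HNNExtension (of of_injective IsAcylindrical)

variable {G : Type u} [Group G] {j t : G}

theorem map_mem_cen_iff {K : Type*} [Group K] (f : G →* K) (hf : Function.Injective f) {x g : G} :
    f x ∈ Cen (f g) ↔ x ∈ Cen g := by
  rw [mem_cen, mem_cen, ← map_mul, ← map_mul, hf.eq_iff]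

/-- An HNN extension with suitable dihedral-like associated subgroups satisfies the conditions. -/
theorem Conditions.hnnExtension (hG : Conditions j t) (hj : IsInvolution j) (ht : IsInvolution t)
    (hjt : j ≠ t) {A B : Subgroup G} (φ : A ≃* B) (hAB : IsAcylindrical A B)
    (hA : ∀ a ∈ A, a * a ≠ 1 → Cen a = Cen (j * t)) (hjtA : j * t ∈ A) :
    Conditions (of j : HNNExtension G A B φ) (of t) := by
  have hinj := of_injective φ
  have hsq : ∀ i k : G, IsInvolution i → IsInvolution k → i ≠ k → i * k * (i * k) ≠ 1 :=
    fun i k hi hk hik h => hG.infinite_order i k hi hk hik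
      (isOfFinOrder_iff_pow_eq_one.2 ⟨2, two_pos, by rw [pow_two, h]⟩)
  have hcenA : ∀ a ∈ A, a * a ≠ 1 → ∀ x : HNNExtension G A B φ, x ∈ Cen (of a) ↔
      ∃ c ∈ Cen (j * t), x = of c := by
    intro a ha haa x
    constructor
    · intro hx
      obtain ⟨c, rfl⟩ := HNNExtension.mem_range_of_commute hAB ⟨a, ha⟩ haa (mem_cen.1 hx)
      rw [map_mem_cen_iff _ hinj, hA a ha haa] at hx
      exact ⟨c, hx, rfl⟩
    · rintro ⟨c, hc, rfl⟩
      rwa [map_mem_cen_iff _ hinj, hA a ha haa]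
  have hcen : ∀ x : HNNExtension G A B φ, x ∈ Cen (of j * of t) ↔
      ∃ c ∈ Cen (j * t), x = of c := by
    rw [← map_mul]
    exact hcenA _ hjtA (hsq j t hj ht hjt)
  have h3 := HNNExtension.not_isOfFinOrder_mul (φ := φ) hG.infinite_order
  refine conditions_of_dichotomy (hj.map of hinj) (ht.map of hinj) (fun h => hjt (hinj h))
    ?_ h3 ?_ ?_ ?_ ?_
  · intro r s hr hs
    obtain ⟨w, r', hr', rfl⟩ := HNNExtension.exists_conj_of_isInvolution hr
    obtain ⟨w', s', hs', rfl⟩ := HNNExtension.exists_conj_of_isInvolution hs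
    obtain ⟨g, rfl⟩ := hG.conj r' s' hr' hs'
    refine ⟨w * of g * w'⁻¹, ?_⟩
    simp only [conjBy, map_mul, map_inv]
    group
  · intro s hs h
    rw [EquivRel] at h
    have h1 : of j * s ∈ Cen (of j * of t) := h ▸ self_mem_cen (of j * s)
    obtain ⟨c, -, hc⟩ := (hcen _).1 h1
    obtain rfl : s = of (j * c) := by rw [map_mul, ← hc, (hj.map of hinj).mul_mul_cancel]
    rw [isInvolution_map_iff _ hinj] at hs
    obtain ⟨a, ha, h2⟩ := hG.equiv_conj (j * c) hs (by
      rw [EquivRel]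
      ext x
      rw [← map_mem_cen_iff _ hinj, map_mul, h, ← map_mul, map_mem_cen_iff _ hinj])
    refine ⟨of a, (map_mem_cen_iff _ hinj).2 ha, ?_⟩
    rw [h2]; simp only [conjBy, map_mul, map_inv]
  · intro x hx
    obtain ⟨c, hc, rfl⟩ := (hcen x).1 hx
    rw [← map_mul, ← map_mul, hG.inverted hj ht hjt.symm hc, map_inv]
  · intro x hx
    obtain ⟨c, hc, rfl⟩ := (hcen x).1 hx
    obtain ⟨w, hw, rfl⟩ := hG.exists_root hj ht hjt hc two_ne_zero
    exact ⟨of w, (hcen _).2 ⟨w, hw, rfl⟩, by rw [← map_mul, zpow_two]⟩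
  · intro i k hi hk hik
    by_cases hfix : ∃ x : HNNExtension.Vertex φ, (i * k) • x = x
    · obtain ⟨x, hx⟩ := hfix
      obtain ⟨w, i', k', hi', hk', rfl, rfl⟩ := HNNExtension.exists_common_conj hi hk hx
      refine CenDichotomy.conj ?_ w
      have hik' : i' ≠ k' := fun h => hik (by rw [h])
      -- If the centralizer leaves `G`, then `i' k'` is conjugate into `A` and its centralizer is a
      -- conjugate of `Cen (j t)`. Otherwise the dichotomy of `G` applies unchanged.
      by_cases hout : ∃ x : HNNExtension G A B φ, x ∈ Cen (of i' * of k') ∧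
          x ∉ (of : G →* HNNExtension G A B φ).range
      · obtain ⟨x, hx, hx'⟩ := hout
        rw [← map_mul, mem_cen] at hx
        obtain ⟨w', a, ha⟩ := HNNExtension.exists_conj_of_commute hx hx'
        have haa : (a : G) * a ≠ 1 := fun h => hsq i' k' hi' hk' hik' (hinj (by
          have h1 : w' * of (a : G) * w'⁻¹ * (w' * of (a : G) * w'⁻¹) =
            w' * of ((a : G) * a) * w'⁻¹ := by rw [map_mul]; group
          rw [map_mul, ha, h1, h, map_one, mul_one, mul_inv_cancel]))
        refine Or.inr ⟨w', fun x => ?_⟩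
        rw [← map_mul, ha, mem_cen_conj, hcenA a a.2 haa, hcen]
      · push Not at hout
        rcases hG.dichotomy hj ht hjt hi' hk' hik' with ⟨z, hz, hz'⟩ | ⟨a, ha⟩
        · refine Or.inl ⟨of z, ?_, by rw [← map_mul, ← map_mul, hz', map_inv]⟩
          ext x
          rw [Subgroup.mem_zpowers_iff]
          constructor
          · intro hx
            obtain ⟨y, rfl⟩ := hout x hx
            rw [← map_mul, map_mem_cen_iff _ hinj, hz] at hx
            obtain ⟨n, rfl⟩ := Subgroup.mem_zpowers_iff.1 hx
            exact ⟨n, by rw [map_zpow]⟩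
          · rintro ⟨n, rfl⟩
            rw [← map_mul, ← map_zpow, map_mem_cen_iff _ hinj, hz]
            exact Subgroup.zpow_mem_zpowers z n
        · refine Or.inr ⟨of a, fun x => ?_⟩
          have key : ∀ y : G, of y ∈ Cen (of i' * of k' : HNNExtension G A B φ) ↔
              (of a : HNNExtension G A B φ)⁻¹ * of y * of a ∈ Cen (of j * of t) := by
            intro y
            rw [← map_mul, ← map_mul of j, ← map_inv, ← map_mul, ← map_mul,
              map_mem_cen_iff _ hinj, map_mem_cen_iff _ hinj, ha]
          constructor
          · intro hx
            obtain ⟨y, rfl⟩ := hout x hx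
            exact (key y).1 hx
          · intro hx
            obtain ⟨c, -, hc⟩ := (hcen _).1 hx
            obtain rfl : x = of (a * c * a⁻¹) := by
              rw [map_mul, map_mul, map_inv, ← hc]; group
            exact (key _).2 hx
    · push Not at hfix
      exact Or.inl (HNNExtension.cen_cyclic_of_no_fixed hAB h3 hi hk hfix)

/-- The edge groups used to conjugate `t` to an involution outside `A t A` are acylindrical. -/
theorem isAcylindrical_dihedral (hG : Conditions j t) (hj : IsInvolution j) (ht : IsInvolution t)
    (hjt : j ≠ t) {a b : G} {ha : j * a * j = a⁻¹} {hb : j * b * j = b⁻¹}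
    (hca : ∀ n : ℤ, n ≠ 0 → Cen (a ^ n) = Cen (j * t))
    (hcb : ∀ n : ℤ, n ≠ 0 → Cen (b ^ n) = Subgroup.zpowers b)
    (hb1 : ∀ n : ℤ, n ≠ 0 → b ^ n ≠ 1) :
    IsAcylindrical (dihedralHom j a hj.mul_self ha).range
      (dihedralHom j b hj.mul_self hb).range := by
  have hsq : ∀ g x : G, x * x ≠ 1 → g⁻¹ * x * g * (g⁻¹ * x * g) ≠ 1 := by
    intro g x hx h
    apply hx
    have : x * x = g * (g⁻¹ * x * g * (g⁻¹ * x * g)) * g⁻¹ := by group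
    rw [this, h]; group
  have hbinj : ∀ m n : ℤ, b ^ m = b ^ n → m = n := by
    intro m n h
    by_contra hne
    exact hb1 (m - n) (sub_ne_zero.2 hne) (by rw [zpow_sub, h, mul_inv_cancel])
  have hconj : ∀ {g x y : G}, g⁻¹ * x * g = y → x = g * y * g⁻¹ := by
    rintro g x y rfl; group
  constructor
  · intro g x hx hxx hgx
    obtain ⟨m, hm, h1⟩ := eq_zpow_of_mem_range hgx (hsq g x hxx)
    obtain ⟨n, hn, rfl⟩ := eq_zpow_of_mem_range hx hxx
    -- All nontrivial powers of `b` have centralizer `⟨b⟩`, so `g` normalizes `⟨b⟩` and sends `b` to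
    -- `b` or `b⁻¹`. Accordingly `g` or `g j` centralizes `b`, hence lies in `⟨b⟩`.
    have h2 : ∀ x, x ∈ Subgroup.zpowers b ↔ g⁻¹ * x * g ∈ Subgroup.zpowers b := by
      intro x
      rw [← hcb n hn, hconj h1, mem_cen_conj, hcb m hm, ← hconj h1, hcb n hn]
    obtain ⟨p, hp⟩ := Subgroup.mem_zpowers_iff.1 ((h2 b).1 (Subgroup.mem_zpowers b))
    obtain ⟨q, hq⟩ := Subgroup.mem_zpowers_iff.1 ((h2 (g * b * g⁻¹)).2 (by
      have : g⁻¹ * (g * b * g⁻¹) * g = b := by group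
      rw [this]; exact Subgroup.mem_zpowers b))
    have hqp : q * p = 1 := by
      apply hbinj
      rw [zpow_mul, hq, conj_zpow, hp, zpow_one]; group
    have hcen : Cen b = Subgroup.zpowers b := by simpa using hcb 1 one_ne_zero
    rcases Int.eq_one_or_neg_one_of_mul_eq_one (mul_comm q p ▸ hqp) with rfl | rfl
    · have hgb : g ∈ Cen b := by
        rw [zpow_one] at hp
        rw [mem_cen]; nth_rw 1 [hp]; group
      rw [hcen] at hgb
      obtain ⟨l, rfl⟩ := Subgroup.mem_zpowers_iff.1 hgb
      exact zpow_mem_range l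
    · have hgb : g * j ∈ Cen b := by
        rw [zpow_neg_one, ← hb] at hp
        rw [mem_cen]
        calc g * j * b = g * (j * b * j) * j := by
              rw [mul_assoc g (j * b * j), hj.mul_mul_cancel_right, mul_assoc]
          _ = b * (g * j) := by rw [hp]; group
      rw [hcen] at hgb
      have hg : g = g * j * j := (hj.mul_mul_cancel_right g).symm
      obtain ⟨l, hl⟩ := Subgroup.mem_zpowers_iff.1 hgb
      rw [hg, ← hl]
      refine mul_mem (zpow_mem_range l) ?_
      simpa using mul_zpow_mem_range (i := j) (y := b) 0
  · intro g x hx hxx hgx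
    obtain ⟨m, hm, h1⟩ := eq_zpow_of_mem_range hgx (hsq g x hxx)
    obtain ⟨n, hn, rfl⟩ := eq_zpow_of_mem_range hx hxx
    -- Comparing centralizers makes `⟨b⟩` conjugate to the divisible group `Cen (j t)`, but `b` has
    -- no square root in `⟨b⟩`.
    have h2 : ∀ x, x ∈ Subgroup.zpowers b ↔ g⁻¹ * x * g ∈ Cen (j * t) := by
      intro x
      rw [← hcb n hn, hconj h1, mem_cen_conj, hca m hm]
    obtain ⟨w, hw, hww⟩ := hG.exists_root hj ht hjt ((h2 b).1 (Subgroup.mem_zpowers b))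
      two_ne_zero
    obtain ⟨q, hq⟩ := Subgroup.mem_zpowers_iff.1 ((h2 (g * w * g⁻¹)).2 (by
      have : g⁻¹ * (g * w * g⁻¹) * g = w := by group
      rwa [this]))
    have : q * 2 = 1 := by
      apply hbinj
      rw [zpow_mul, hq, conj_zpow, hww, zpow_one]; group
    omega

end Extension

end SharplyTwoTransitive

/-! ### Construction of the extension. -/

theorem proposition1p2 {G : Type u} [Group G] (j t t' : G)
    (hj : SharplyTwoTransitive.IsInvolution j)
    (ht : SharplyTwoTransitive.IsInvolution t)
    (ht' : SharplyTwoTransitive.IsInvolution t')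
    (hjt : j ≠ t)
    (hjt' : SharplyTwoTransitive.conjBy j t' = t)
    (hG : SharplyTwoTransitive.Conditions j t)
    (v : G) (hv : SharplyTwoTransitive.IsInvolution v) (hvj : v ≠ j) :
    ∃ (G₁ : Type u) (_ : Group G₁) (ι : G →* G₁),
      Function.Injective ι ∧
      (∃ f ∈ SharplyTwoTransitive.Cen (ι j),
        SharplyTwoTransitive.conjBy (ι t) f = ι v) ∧
      SharplyTwoTransitive.Conditions (ι j) (ι t) := by
  open SharplyTwoTransitive in
  by_cases hvA : v ∈ DoubleCoset.doubleCoset t (Cen j : Set G) (Cen j)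
  · obtain ⟨f, hf, hvf⟩ := hG.eq_conj_of_mem_doubleCoset hj ht hjt hv hvA
    exact ⟨G, inferInstance, MonoidHom.id G, Function.injective_id, ⟨f, hf, hvf.symm⟩, hG⟩
  obtain ⟨v', hv', hequiv, hcyc⟩ := hG.cen_cyclic v hv hvA hvj
  rw [EquivRel] at hequiv
  have hv'j : v' ≠ j := by
    rintro rfl
    refine hj.mul_ne_one hvj.symm ?_
    have := self_mem_cen (v' * v)
    rwa [hcyc, hj.mul_self, Subgroup.zpowers_one_eq_bot, Subgroup.mem_bot] at this
  have hb := mul_mul_self_of_involutions hj hv'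
  have hb0 : j * v' ≠ 1 := hj.mul_ne_one hv'j.symm
  have hb1 : ∀ n : ℤ, n ≠ 0 → (j * v') ^ n ≠ 1 := fun n hn =>
    hG.zpow_ne_one hj hv' hv'j (self_mem_cen _) hb0 hn
  have hcb : ∀ n : ℤ, n ≠ 0 → Cen ((j * v') ^ n) = Subgroup.zpowers (j * v') := fun n hn => by
    rw [hG.cen_eq_cen hv' hv'j (zpow_mem (self_mem_cen _) n) (hb1 n hn), hequiv, hcyc]
  obtain ⟨k, hk⟩ := Subgroup.mem_zpowers_iff.1 (hcyc ▸ self_mem_cen (j * v))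
  have hk0 : k ≠ 0 := by
    rintro rfl
    exact hj.mul_ne_one hvj.symm (by rw [← hk, zpow_zero])
  -- The exponent matches `j v = (j v') ^ k`, so an isomorphism with `a ↦ j v'` sends `j t` to `j
  -- v`.
  obtain ⟨a, haC, hak⟩ := hG.exists_root hj ht hjt (self_mem_cen (j * t)) hk0
  have ha := hG.inverted hj ht hjt.symm haC
  have ha0 : a ≠ 1 := by
    rintro rfl
    exact hj.mul_ne_one hjt (by rw [← hak, one_zpow])
  have ha1 : ∀ n : ℤ, n ≠ 0 → a ^ n ≠ 1 := fun n hn =>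
    hG.zpow_ne_one hj ht hjt.symm haC ha0 hn
  have hca : ∀ n : ℤ, n ≠ 0 → Cen (a ^ n) = Cen (j * t) := fun n hn =>
    hG.cen_eq_cen ht hjt.symm (zpow_mem haC n) (ha1 n hn)
  let ea := MonoidHom.ofInjective (dihedralHom_injective (hi := hj.mul_self) (hy := ha) ha1)
  let eb := MonoidHom.ofInjective (dihedralHom_injective (hi := hj.mul_self) (hy := hb) hb1)
  let φ := ea.symm.trans eb
  have hφ : ∀ d, φ (ea d) = eb d := fun d => by
    simp only [φ, MulEquiv.trans_apply, MulEquiv.symm_apply_apply]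
  have hAB := isAcylindrical_dihedral hG hj ht hjt (ha := ha) (hb := hb) hca hcb hb1
  have htj : (HNNExtension.of j : HNNExtension G _ _ φ) =
      HNNExtension.t * HNNExtension.of j * HNNExtension.t⁻¹ := by
    -- The reflection `sr 0` is `j` in both dihedral subgroups, so the stable letter commutes with
    -- `j`.
    have h := HNNExtension.equiv_eq_conj (φ := φ) (ea (.sr (0 : ℤ)))
    rw [hφ] at h
    simpa [ea, eb, MonoidHom.ofInjective_apply, dihedralHom_sr] using h
  have htv : (HNNExtension.of (j * v) : HNNExtension G _ _ φ) =
      HNNExtension.t * HNNExtension.of (j * t) * HNNExtension.t⁻¹ := by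
    have h := HNNExtension.equiv_eq_conj (φ := φ) (ea (.r k))
    rw [hφ] at h
    simp only [ea, eb, MonoidHom.ofInjective_apply, dihedralHom_r] at h
    rwa [hk, hak] at h
  refine ⟨HNNExtension G _ _ φ, inferInstance, HNNExtension.of, HNNExtension.of_injective φ,
    ⟨HNNExtension.t⁻¹, ?_, ?_⟩, ?_⟩
  · refine inv_mem (mem_cen.2 ?_)
    nth_rw 2 [htj]; group
  · rw [conjBy, inv_inv]
    have h1 : (HNNExtension.of j : HNNExtension G _ _ φ) *
        (HNNExtension.t * HNNExtension.of t * HNNExtension.t⁻¹) =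
        HNNExtension.of j * HNNExtension.of v := by
      nth_rw 1 [htj]
      rw [← map_mul, htv, map_mul]; group
    exact mul_left_cancel h1
  · refine hG.hnnExtension hj ht hjt φ hAB (fun x hx hxx => ?_) ?_
    · obtain ⟨n, hn, rfl⟩ := eq_zpow_of_mem_range hx hxx
      exact hca n hn
    · rw [← hak]; exact zpow_mem_range k
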